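/- Let $\mathcal V$ be a category with finite products, pullbacks and all small coproducts which is cartesian closed, with internal homs $[X,Y]$ and evaluations $\mathrm{ev}_X\colon X\times[X,Y]\to Y$, and extensive, i.e. for every set $I$ and objects $(X_i)_{i\in I}$ the coproduct functor $\prod_i\mathcal V/X_i\to\mathcal V/\coprod_i X_i$ is an equivalence. Let $*$ be the terminal object. Let $\mathcal G$ be a conservative family of objects of $\mathcal V$: a map $f\colon Y\to Z$ is an isomorphism if and only if $f_*\colon\mathcal V(X,Y)\to\mathcal V(X,Z)$ is a bijection for every $X\in\mathcal G$. Let $\mathcal C$ be a $\mathcal V$-category with a (small) set of objects, let $F\colon\mathcal C^{\mathrm{op}}\to\mathcal V$ be a $\mathcal V$-functor, and let $\mathrm{ev}^F_{A,B}\colon\mathcal C(A,B)\times FB\to FA$ be the transpose of its action $\mathcal C(A,B)\to[FB,FA]$. Suppose that for every $X\in\mathcal G$: * $\mathcal C$ has all $\mathcal V$-tensors by $X$: for every $C\in\mathcal C$ there are an object $C\otimes X\in\mathcal C$ and a map $\gamma\colon X\to\mathcal C(C,C\otimes X)$ such that, for all $A\in\mathcal C$, the map $\mathcal C(C\otimes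 X,A)\to[X,\mathcal C(C,A)]$ induced by $\gamma$ and composition is an isomorphism; * $F$ preserves them: for every $C$ and every such tensor $(C\otimes X,\gamma)$ there is an isomorphism $\varphi\colon[X,FC]\cong F(C\otimes X)$ with $\mathrm{ev}^F_{C,C\otimes X}\circ(\gamma\times\varphi)=\mathrm{ev}_X\colon X\times[X,FC]\to FC$. Let $\int_{\mathcal C}F$ be the internal category of elements of $F$: the category internal to $\mathcal V$ with object of objects $\coprod_A FA$ and object of morphisms $\coprod_{A,B}\mathcal C(A,B)\times FB$, whose source, target, identity and composition are given on summands by $\mathrm{ev}^F_{A,B}$, by the projection to $FB$, by the identities of $\mathcal C$, and by the composition of $\mathcal C$ (by extensivity, the object of composable pairs is $\coprod_{A,B,D}\mathcal C(A,B)\times\mathcal C(B,D)\times FD$). For a category $\mathbb A$ internal to $\mathcal V$, let $\mathrm{Und}\,\mathbb A$ be its underlying $\mathcal V$-category: its objects are the maps $a\colon *\to\mathbb A_0$, and the hom-object from $a$ to $b$ is the pullback of $(s,t)\colon\mathbb A_1\to\mathbb A_0\times\mathbb A_0$ along $(a,b)\colon *\to\mathbb A_0\times\mathbb A_0$. Let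 $C\in\mathcal C$ and $x\colon *\to FC$. Then the following are equivalent: 1. $F$ is $\mathcal V$-representable by $(C,x)$, i.e. the $\mathcal V$-natural transformation $\mathcal C(-,C)\Rightarrow F$ that corresponds to $x$ under the Yoneda lemma is a $\mathcal V$-natural isomorphism; 2. the object $(C,x)\colon *\xrightarrow{x}FC\hookrightarrow\coprod_A FA$ is $\mathcal V$-terminal in $\mathrm{Und}\int_{\mathcal C}F$, i.e. for every object $a$ of $\mathrm{Und}\int_{\mathcal C}F$ the hom-object $(\mathrm{Und}\int_{\mathcal C}F)(a,(C,x))$ is a terminal object of $\mathcal V$. -/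

import Mathlib

open CategoryTheory Limits MonoidalCategory CartesianMonoidalCategory Opposite
open scoped CategoryTheory.MonoidalClosed

universe w v u

noncomputable section

namespace EnrichedRep

section Extensive

variable {V : Type u} [Category.{v} V] [HasCoproducts.{w} V]

/-- The functor `∏ V/Xᵢ ⥤ V/∐ Xᵢ` taking coproducts of families of maps. -/
@[simps]
def sigmaOver {I : Type w} (X : I → V) : (∀ i, Over (X i)) ⥤ Over (∐ X) where
  obj f := Over.mk (Limits.Sigma.map fun i => (f i).hom)
  map g := Over.homMk (Limits.Sigma.map fun i => (g i).left) (by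
    apply Limits.Sigma.hom_ext
    intro i
    simp)
  map_id f := by
    ext
    apply Limits.Sigma.hom_ext
    intro i
    simp
  map_comp f g := by
    ext
    apply Limits.Sigma.hom_ext
    intro i
    simp

variable (V) in
/-- A category with small coproducts is extensive if, for every small family of objects `X i`,
the functor `∏ V/Xᵢ ⥤ V/∐ Xᵢ` is an equivalence of categories. -/
class IsExtensive : Prop where
  isEquivalence : ∀ {I : Type w} (X : I → V), (sigmaOver X).IsEquivalence

variable [IsExtensive.{w} V]

lemma sigma_full {I : Type w} {X Y Z : I → V} (f : ∀ i, Y i ⟶ X i) (g : ∀ i, Z i ⟶ X i)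
    (a : ∐ Y ⟶ ∐ Z) (ha : a ≫ Limits.Sigma.map g = Limits.Sigma.map f) :
    ∃ b : ∀ i, Y i ⟶ Z i, (∀ i, b i ≫ g i = f i) ∧ Limits.Sigma.map b = a := by
  have := IsExtensive.isEquivalence X
  let F : ∀ i, Over (X i) := fun i => Over.mk (f i)
  let G : ∀ i, Over (X i) := fun i => Over.mk (g i)
  let A : (sigmaOver X).obj F ⟶ (sigmaOver X).obj G := Over.homMk a ha
  obtain ⟨b, hb⟩ := (sigmaOver X).map_surjective A
  exact ⟨fun i => (b i).left, fun i => Over.w (b i), congrArg (fun t => t.left) hb⟩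

lemma sigma_faithful {I : Type w} {X Y Z : I → V} (g : ∀ i, Z i ⟶ X i)
    (b b' : ∀ i, Y i ⟶ Z i) (h : ∀ i, b i ≫ g i = b' i ≫ g i)
    (hb : Limits.Sigma.map b = Limits.Sigma.map b') (i : I) : b i = b' i := by
  have := IsExtensive.isEquivalence X
  let F : ∀ i, Over (X i) := fun i => Over.mk (b i ≫ g i)
  let G : ∀ i, Over (X i) := fun i => Over.mk (g i)
  let B : F ⟶ G := fun i => Over.homMk (b i) rfl
  let B' : F ⟶ G := fun i => Over.homMk (b' i) (h i).symm
  have : B = B' := (sigmaOver X).map_injective (by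
    ext
    exact hb)
  exact congrArg (fun t => t.left) (congrFun this i)

lemma sigma_essSurj {I : Type w} {X : I → V} {Y : V} (g : Y ⟶ ∐ X) :
    ∃ (Z : I → V) (z : ∀ i, Z i ⟶ X i) (e : ∐ Z ≅ Y), e.hom ≫ g = Limits.Sigma.map z := by
  have := IsExtensive.isEquivalence X
  let G : Over (∐ X) := Over.mk g
  exact ⟨fun i => ((sigmaOver X).objPreimage G i).left,
    fun i => ((sigmaOver X).objPreimage G i).hom,
    (Over.forget _).mapIso ((sigmaOver X).objObjPreimageIso G),
    Over.w ((sigmaOver X).objObjPreimageIso G).hom⟩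

variable [HasPullbacks V]

lemma isPullback_sigma {I : Type w} {Y X : I → V} (f : ∀ i, Y i ⟶ X i) (i : I) :
    IsPullback (Sigma.ι Y i) (f i) (Limits.Sigma.map f) (Sigma.ι X i) := by
  let P : I → V := fun i => pullback (Limits.Sigma.map f) (Sigma.ι X i)
  let p : ∀ i, P i ⟶ X i := fun i => pullback.snd _ _
  let a : ∐ P ⟶ ∐ Y := Limits.Sigma.desc fun i => pullback.fst _ _
  have ha : a ≫ Limits.Sigma.map f = Limits.Sigma.map p := by
    apply Limits.Sigma.hom_ext
    intro i
    simp [a, p, pullback.condition]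
  obtain ⟨b, hb, hba⟩ := sigma_full p f a ha
  have hbi : ∀ i, b i ≫ Sigma.ι Y i = pullback.fst _ _ := fun i => by
    have := congrArg (fun t => Sigma.ι P i ≫ t) hba
    simpa [a] using this
  let c : ∀ i, Y i ⟶ P i := fun i => pullback.lift (Sigma.ι Y i) (f i) (by simp)
  have hc1 : ∀ i, c i ≫ pullback.fst _ _ = Sigma.ι Y i := fun i => pullback.lift_fst _ _ _
  have hc2 : ∀ i, c i ≫ pullback.snd _ _ = f i := fun i => pullback.lift_snd _ _ _
  have hcb : ∀ i, c i ≫ b i = 𝟙 _ := by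
    refine sigma_faithful f _ _ (fun i => by simp [hb, hc2, p]) ?_
    apply Limits.Sigma.hom_ext
    intro i
    simp [hbi, hc1]
  have hbc : ∀ i, b i ≫ c i = 𝟙 _ := fun i => by
    apply pullback.hom_ext
    · simp [hc1, hbi]
    · simp [hc2, hb, p]
  exact IsPullback.of_iso_pullback ⟨by simp⟩ ⟨c i, b i, hcb i, hbc i⟩ (hc1 i) (hc2 i)

/-- In terms of arbitrary coproduct cofans: the summands are the pullbacks. -/
lemma isPullback_cofan {I : Type w} {Y X : I → V} {Y' X' : V} (y : ∀ i, Y i ⟶ Y')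
    (hy : IsColimit (Cofan.mk Y' y)) (x : ∀ i, X i ⟶ X') (hx : IsColimit (Cofan.mk X' x))
    (f : ∀ i, Y i ⟶ X i) (g : Y' ⟶ X') (h : ∀ i, y i ≫ g = f i ≫ x i) (i : I) :
    IsPullback (y i) (f i) g (x i) := by
  let e : ∐ Y ≅ Y' := (coproductIsCoproduct Y).coconePointUniqueUpToIso hy
  let e' : ∐ X ≅ X' := (coproductIsCoproduct X).coconePointUniqueUpToIso hx
  have h1 : ∀ i, Sigma.ι Y i ≫ e.hom = y i :=
    fun i => (coproductIsCoproduct Y).comp_coconePointUniqueUpToIso_hom hy ⟨i⟩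
  have h2 : ∀ i, Sigma.ι X i ≫ e'.hom = x i :=
    fun i => (coproductIsCoproduct X).comp_coconePointUniqueUpToIso_hom hx ⟨i⟩
  refine IsPullback.of_iso (isPullback_sigma f i) (Iso.refl _) e (Iso.refl _) e' ?_ ?_ ?_ ?_
  · simp [h1]
  · simp
  · apply Limits.Sigma.hom_ext
    intro j
    rw [Limits.Sigma.ι_map_assoc, h2, reassoc_of% h1, h]
  · simp [h2]

/-- Coproducts are stable under pullback. -/
lemma isColimit_of_isPullback {I : Type w} {X : I → V} {X' : V} (x : ∀ i, X i ⟶ X')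
    (hx : IsColimit (Cofan.mk X' x)) {Y : I → V} {Y' : V} (y : ∀ i, Y i ⟶ Y')
    (f : ∀ i, Y i ⟶ X i) (g : Y' ⟶ X') (h : ∀ i, IsPullback (y i) (f i) g (x i)) :
    Nonempty (IsColimit (Cofan.mk Y' y)) := by
  let e : ∐ X ≅ X' := (coproductIsCoproduct X).coconePointUniqueUpToIso hx
  have h2 : ∀ i, Sigma.ι X i ≫ e.hom = x i :=
    fun i => (coproductIsCoproduct X).comp_coconePointUniqueUpToIso_hom hx ⟨i⟩
  obtain ⟨Z, z, φ, hφ⟩ := sigma_essSurj (g ≫ e.inv)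
  have hp : ∀ i, IsPullback (Sigma.ι Z i ≫ φ.hom) (z i) g (x i) := by
    intro i
    refine IsPullback.of_iso (isPullback_sigma z i) (Iso.refl _) φ (Iso.refl _) e ?_ ?_ ?_ ?_
    · simp
    · simp
    · rw [← hφ]; simp
    · simp [h2]
  let ψ : ∀ i, Y i ≅ Z i := fun i => (h i).isoIsPullback _ _ (hp i)
  have hψ : ∀ i, (ψ i).hom ≫ Sigma.ι Z i ≫ φ.hom = y i :=
    fun i => IsPullback.isoIsPullback_hom_fst _ _ (h i) (hp i)
  have h3 : Sigma.desc y = (Sigma.mapIso ψ ≪≫ φ).hom := by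
    apply Limits.Sigma.hom_ext
    intro i
    simp [hψ]
  rw [Cofan.nonempty_isColimit_iff_isIso_sigmaDesc]
  change IsIso (Sigma.desc y)
  rw [h3]
  infer_instance

/-- A fibre product over `∐ Z k` of `∐ X i k` and `∐ S j` is the coproduct of the fibre products
of the summands. -/
lemma isColimit_fiberProduct {I J K : Type w} {X : I → K → V} {A₁ : V}
    (x : ∀ p : I × K, X p.1 p.2 ⟶ A₁) (hx : IsColimit (Cofan.mk A₁ x))
    {Z : K → V} {A₀ : V} (z : ∀ k, Z k ⟶ A₀) (hz : IsColimit (Cofan.mk A₀ z))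
    (t : A₁ ⟶ A₀) (t' : ∀ i k, X i k ⟶ Z k) (ht : ∀ i k, x (i, k) ≫ t = t' i k ≫ z k)
    (α : J → K) {S : J → V} {S' : V} (σ : ∀ j, S j ⟶ S') (hσ : IsColimit (Cofan.mk S' σ))
    (s : S' ⟶ A₀) (s' : ∀ j, S j ⟶ Z (α j)) (hs : ∀ j, σ j ≫ s = s' j ≫ z (α j))
    {W : I → J → V} (w₁ : ∀ i j, W i j ⟶ X i (α j)) (w₂ : ∀ i j, W i j ⟶ S j)
    (hw : ∀ i j, IsPullback (w₁ i j) (w₂ i j) (t' i (α j)) (s' j))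
    {P : V} (p₁ : P ⟶ A₁) (p₂ : P ⟶ S') (hP : IsPullback p₁ p₂ t s)
    (w : ∀ q : I × J, W q.1 q.2 ⟶ P) (h₁ : ∀ i j, w (i, j) ≫ p₁ = w₁ i j ≫ x (i, α j))
    (h₂ : ∀ i j, w (i, j) ≫ p₂ = w₂ i j ≫ σ j) :
    Nonempty (IsColimit (Cofan.mk P w)) := by
  let T : K → V := fun k => ∐ fun i => X i k
  let τ : ∀ k, T k ⟶ A₁ := fun k => Sigma.desc fun i => x (i, k)
  have hιτ : ∀ i k, Sigma.ι (fun i => X i k) i ≫ τ k = x (i, k) := fun i k => Sigma.ι_desc _ _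
  have hτ : IsColimit (Cofan.mk A₁ τ) :=
    Cofan.IsColimit.mk _
      (fun c => Cofan.IsColimit.desc hx fun p => Sigma.ι (fun i => X i p.2) p.1 ≫ c.inj p.2)
      (fun c k => by
        apply Limits.Sigma.hom_ext
        intro i
        have := Cofan.IsColimit.fac hx (fun p => Sigma.ι (fun i => X i p.2) p.1 ≫ c.inj p.2) (i, k)
        simp only [cofan_mk_inj] at this ⊢
        rw [reassoc_of% hιτ, this])
      (fun c m hm => by
        apply Cofan.IsColimit.hom_ext hx
        intro p
        have := Cofan.IsColimit.fac hx (fun p => Sigma.ι (fun i => X i p.2) p.1 ≫ c.inj p.2) p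
        rw [this]
        have hm' := hm p.2
        simp only [cofan_mk_inj] at hm' ⊢
        rw [← hm', reassoc_of% hιτ])
  let θ : ∀ k, T k ⟶ Z k := fun k => Sigma.desc fun i => t' i k
  have hιθ : ∀ i k, Sigma.ι (fun i => X i k) i ≫ θ k = t' i k := fun i k => Sigma.ι_desc _ _
  have hτt : ∀ k, τ k ≫ t = θ k ≫ z k := fun k => by
    apply Limits.Sigma.hom_ext
    intro i
    rw [reassoc_of% hιτ, reassoc_of% hιθ, ht]
  have hE := isPullback_cofan τ hτ z hz θ t hτt
  let Q : J → V := fun j => pullback p₂ (σ j)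
  let q : ∀ j, Q j ⟶ P := fun j => pullback.fst _ _
  let q' : ∀ j, Q j ⟶ S j := fun j => pullback.snd _ _
  have hQ : ∀ j, IsPullback (q j) (q' j) p₂ (σ j) := fun j => IsPullback.of_hasPullback _ _
  obtain ⟨hq⟩ := isColimit_of_isPullback σ hσ q q' p₂ hQ
  have hQo : ∀ j, IsPullback (q j ≫ p₁) (q' j) t (s' j ≫ z (α j)) := fun j => by
    have := (hQ j).flip.paste_vert hP.flip
    rw [hs] at this
    exact this.flip
  let g : ∀ j, Q j ⟶ T (α j) := fun j => (hE (α j)).lift (q j ≫ p₁) (q' j ≫ s' j) (by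
    rw [(hQo j).w, Category.assoc])
  have hg₁ : ∀ j, g j ≫ τ (α j) = q j ≫ p₁ := fun j => (hE (α j)).lift_fst _ _ _
  have hg₂ : ∀ j, g j ≫ θ (α j) = q' j ≫ s' j := fun j => (hE (α j)).lift_snd _ _ _
  have hR : ∀ j, IsPullback (g j) (q' j) (θ (α j)) (s' j) := fun j =>
    IsPullback.of_right (by rw [hg₁]; exact hQo j) (hg₂ j) (hE (α j))
  let r : ∀ j i, W i j ⟶ Q j := fun j i => (hQ j).lift (w (i, j)) (w₂ i j) (h₂ i j)
  have hr₁ : ∀ j i, r j i ≫ q j = w (i, j) := fun j i => (hQ j).lift_fst _ _ _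
  have hr₂ : ∀ j i, r j i ≫ q' j = w₂ i j := fun j i => (hQ j).lift_snd _ _ _
  have hrg : ∀ j i, r j i ≫ g j = w₁ i j ≫ Sigma.ι (fun i => X i (α j)) i := fun j i => by
    apply (hE (α j)).hom_ext
    · rw [Category.assoc, Category.assoc, hg₁, hιτ, reassoc_of% hr₁, h₁]
    · rw [Category.assoc, Category.assoc, hg₂, hιθ, reassoc_of% hr₂, (hw i j).w]
  have hN : ∀ j i, IsPullback (r j i) (w₁ i j) (g j) (Sigma.ι (fun i => X i (α j)) i) :=
    fun j i => IsPullback.of_right (by rw [hr₂, hιθ]; exact (hw i j).flip) (hrg j i) (hR j).flip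
  have hr : ∀ j, Nonempty (IsColimit (Cofan.mk (Q j) (r j))) := fun j =>
    isColimit_of_isPullback _ (coproductIsCoproduct fun i => X i (α j)) (r j) (fun i => w₁ i j)
      (g j) (hN j)
  let hr' : ∀ j, IsColimit (Cofan.mk (Q j) (r j)) := fun j => (hr j).some
  refine ⟨Cofan.IsColimit.mk _
      (fun c => Cofan.IsColimit.desc hq fun j => Cofan.IsColimit.desc (hr' j) fun i => c.inj (i, j))
      (fun c p => ?_) (fun c m hm => ?_)⟩
  · obtain ⟨i, j⟩ := p
    have e₁ := Cofan.IsColimit.fac hq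
      (fun j => Cofan.IsColimit.desc (hr' j) fun i => c.inj (i, j)) j
    have e₂ := Cofan.IsColimit.fac (hr' j) (fun i => c.inj (i, j)) i
    simp only [cofan_mk_inj] at e₁ e₂ ⊢
    rw [← hr₁, Category.assoc, e₁, e₂]
  · apply Cofan.IsColimit.hom_ext hq
    intro j
    have e₁ := Cofan.IsColimit.fac hq
      (fun j => Cofan.IsColimit.desc (hr' j) fun i => c.inj (i, j)) j
    rw [e₁]
    apply Cofan.IsColimit.hom_ext (hr' j)
    intro i
    have e₂ := Cofan.IsColimit.fac (hr' j) (fun i => c.inj (i, j)) i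
    rw [e₂]
    have hm' := hm (i, j)
    simp only [cofan_mk_inj] at hm' ⊢
    rw [← hm', ← hr₁, Category.assoc]

end Extensive
section Internal

variable (V : Type u) [Category.{v} V] [HasPullbacks V]

/-- An internal category to `V`. Associativity is stated for generalized elements, i.e. for all
composable triples `f, g, h : Y ⟶ mor`, equivalently for the universal such triple. -/
structure InternalCategory where
  /-- the object of objects -/
  obj : V
  /-- the object of morphisms -/
  mor : V
  src : mor ⟶ obj
  tgt : mor ⟶ obj
  idm : obj ⟶ mor
  comp : pullback tgt src ⟶ mor
  idm_src : idm ≫ src = 𝟙 obj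
  idm_tgt : idm ≫ tgt = 𝟙 obj
  comp_src : comp ≫ src = pullback.fst tgt src ≫ src
  comp_tgt : comp ≫ tgt = pullback.snd tgt src ≫ tgt
  id_comp : pullback.lift (src ≫ idm) (𝟙 mor)
    (by rw [Category.assoc, idm_tgt, Category.comp_id, Category.id_comp]) ≫ comp = 𝟙 mor
  comp_id : pullback.lift (𝟙 mor) (tgt ≫ idm)
    (by rw [Category.assoc, idm_src, Category.comp_id, Category.id_comp]) ≫ comp = 𝟙 mor
  assoc : ∀ {Y : V} (f g h : Y ⟶ mor) (hfg : f ≫ tgt = g ≫ src) (hgh : g ≫ tgt = h ≫ src),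
    pullback.lift (pullback.lift f g hfg ≫ comp) h
      (by rw [Category.assoc, comp_tgt, pullback.lift_snd_assoc, hgh]) ≫ comp =
    pullback.lift f (pullback.lift g h hgh ≫ comp)
      (by rw [Category.assoc, comp_src, pullback.lift_fst_assoc, hfg]) ≫ comp

end Internal

section Underlying

variable {V : Type u} [Category.{v} V] [HasPullbacks V] [CartesianMonoidalCategory V]

/-- The objects of the underlying `V`-category of an internal category: its global elements. -/
def Und (𝔸 : InternalCategory V) : Type v := 𝟙_ V ⟶ 𝔸.obj

namespace Und

variable (𝔸 : InternalCategory V)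

/-- The hom-objects of the underlying `V`-category. -/
abbrev homObj (A B : 𝟙_ V ⟶ 𝔸.obj) : V :=
  pullback (lift 𝔸.src 𝔸.tgt) (lift A B)

/-- The projection from the hom-object to the object of morphisms. -/
abbrev proj (A B : 𝟙_ V ⟶ 𝔸.obj) : homObj 𝔸 A B ⟶ 𝔸.mor := pullback.fst _ _

variable {𝔸}

lemma proj_src (A B : 𝟙_ V ⟶ 𝔸.obj) : proj 𝔸 A B ≫ 𝔸.src = toUnit _ ≫ A := by
  have h := congrArg (· ≫ fst _ _) (pullback.condition (f := lift 𝔸.src 𝔸.tgt) (g := lift A B))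
  simp only [Category.assoc, lift_fst] at h
  rw [h, toUnit_unique (pullback.snd _ _) (toUnit _)]

lemma proj_tgt (A B : 𝟙_ V ⟶ 𝔸.obj) : proj 𝔸 A B ≫ 𝔸.tgt = toUnit _ ≫ B := by
  have h := congrArg (· ≫ snd _ _) (pullback.condition (f := lift 𝔸.src 𝔸.tgt) (g := lift A B))
  simp only [Category.assoc, lift_snd] at h
  rw [h, toUnit_unique (pullback.snd _ _) (toUnit _)]

/-- Generalized elements of the hom-object are generalized morphisms from `A` to `B`. -/
def homLift {A B : 𝟙_ V ⟶ 𝔸.obj} {Y : V} (f : Y ⟶ 𝔸.mor) (hs : f ≫ 𝔸.src = toUnit _ ≫ A)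
    (ht : f ≫ 𝔸.tgt = toUnit _ ≫ B) : Y ⟶ homObj 𝔸 A B :=
  pullback.lift f (toUnit _) (by rw [comp_lift, comp_lift, hs, ht])

@[simp]
lemma homLift_proj {A B : 𝟙_ V ⟶ 𝔸.obj} {Y : V} (f : Y ⟶ 𝔸.mor)
    (hs : f ≫ 𝔸.src = toUnit _ ≫ A) (ht : f ≫ 𝔸.tgt = toUnit _ ≫ B) :
    homLift f hs ht ≫ proj 𝔸 A B = f := pullback.lift_fst _ _ _

lemma hom_ext {A B : 𝟙_ V ⟶ 𝔸.obj} {Y : V} {f g : Y ⟶ homObj 𝔸 A B}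
    (h : f ≫ proj 𝔸 A B = g ≫ proj 𝔸 A B) : f = g :=
  pullback.hom_ext h (toUnit_unique _ _)

lemma comp_eq_src {A B C : 𝟙_ V ⟶ 𝔸.obj} {Y : V} (a : Y ⟶ homObj 𝔸 A B) (b : Y ⟶ homObj 𝔸 B C) :
    (a ≫ proj 𝔸 A B) ≫ 𝔸.tgt = (b ≫ proj 𝔸 B C) ≫ 𝔸.src := by
  rw [Category.assoc, Category.assoc, proj_tgt, proj_src, ← Category.assoc, ← Category.assoc,
    toUnit_unique (a ≫ toUnit _) (b ≫ toUnit _)]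

/-- Composition in the underlying `V`-category. -/
def compHom (A B C : 𝟙_ V ⟶ 𝔸.obj) : homObj 𝔸 A B ⊗ homObj 𝔸 B C ⟶ homObj 𝔸 A C :=
  homLift (pullback.lift (fst _ _ ≫ proj 𝔸 A B) (snd _ _ ≫ proj 𝔸 B C) (comp_eq_src _ _) ≫ 𝔸.comp)
    (by rw [Category.assoc, 𝔸.comp_src, pullback.lift_fst_assoc, Category.assoc, proj_src,
          ← Category.assoc, toUnit_unique (fst _ _ ≫ toUnit _) (toUnit _)])
    (by rw [Category.assoc, 𝔸.comp_tgt, pullback.lift_snd_assoc, Category.assoc, proj_tgt,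
          ← Category.assoc, toUnit_unique (snd _ _ ≫ toUnit _) (toUnit _)])

/-- Identities in the underlying `V`-category. -/
def idHom (A : 𝟙_ V ⟶ 𝔸.obj) : 𝟙_ V ⟶ homObj 𝔸 A A :=
  homLift (A ≫ 𝔸.idm)
    (by rw [Category.assoc, 𝔸.idm_src, Category.comp_id, toUnit_unique (toUnit _) (𝟙 _),
          Category.id_comp])
    (by rw [Category.assoc, 𝔸.idm_tgt, Category.comp_id, toUnit_unique (toUnit _) (𝟙 _),
          Category.id_comp])

lemma compHom_proj {A B C : 𝟙_ V ⟶ 𝔸.obj} {Y : V} (f : Y ⟶ homObj 𝔸 A B ⊗ homObj 𝔸 B C)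
    {a b : Y ⟶ 𝔸.mor} (ha : f ≫ fst _ _ ≫ proj 𝔸 A B = a) (hb : f ≫ snd _ _ ≫ proj 𝔸 B C = b)
    (h : a ≫ 𝔸.tgt = b ≫ 𝔸.src) :
    f ≫ compHom A B C ≫ proj 𝔸 A C = pullback.lift a b h ≫ 𝔸.comp := by
  subst ha hb
  rw [compHom, homLift_proj, ← Category.assoc]
  congr 1
  apply pullback.hom_ext
  · rw [Category.assoc, pullback.lift_fst, pullback.lift_fst]
  · rw [Category.assoc, pullback.lift_snd, pullback.lift_snd]

lemma id_comp_aux (A B : 𝟙_ V ⟶ 𝔸.obj) :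
    (λ_ (homObj 𝔸 A B)).inv ≫ idHom A ▷ homObj 𝔸 A B ≫ compHom A A B = 𝟙 _ := by
  apply hom_ext
  have h : (proj 𝔸 A B ≫ 𝔸.src ≫ 𝔸.idm) ≫ 𝔸.tgt = proj 𝔸 A B ≫ 𝔸.src := by
    simp [𝔸.idm_tgt]
  have ha : ((λ_ (homObj 𝔸 A B)).inv ≫ idHom A ▷ homObj 𝔸 A B) ≫ fst _ _ ≫ proj 𝔸 A A =
      proj 𝔸 A B ≫ 𝔸.src ≫ 𝔸.idm := by
    have : idHom A ≫ proj 𝔸 A A = A ≫ 𝔸.idm := homLift_proj _ _ _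
    simp only [Category.assoc, whiskerRight_fst_assoc, this]
    rw [← Category.assoc (proj 𝔸 A B), proj_src]
    simp
  have e : pullback.lift (proj 𝔸 A B ≫ 𝔸.src ≫ 𝔸.idm) (proj 𝔸 A B) h =
      proj 𝔸 A B ≫ pullback.lift (𝔸.src ≫ 𝔸.idm) (𝟙 _) (by simp [𝔸.idm_tgt]) := by
    apply pullback.hom_ext
    · rw [Category.assoc, pullback.lift_fst, pullback.lift_fst]
    · rw [Category.assoc, pullback.lift_snd, pullback.lift_snd, Category.comp_id]
  have key := compHom_proj ((λ_ (homObj 𝔸 A B)).inv ≫ idHom A ▷ homObj 𝔸 A B)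
    (b := proj 𝔸 A B) ha (by simp) h
  rw [e, Category.assoc (proj 𝔸 A B), 𝔸.id_comp] at key
  simpa using key

lemma comp_id_aux (A B : 𝟙_ V ⟶ 𝔸.obj) :
    (ρ_ (homObj 𝔸 A B)).inv ≫ homObj 𝔸 A B ◁ idHom B ≫ compHom A B B = 𝟙 _ := by
  apply hom_ext
  have h : proj 𝔸 A B ≫ 𝔸.tgt = (proj 𝔸 A B ≫ 𝔸.tgt ≫ 𝔸.idm) ≫ 𝔸.src := by
    simp [𝔸.idm_src]
  have hb : ((ρ_ (homObj 𝔸 A B)).inv ≫ homObj 𝔸 A B ◁ idHom B) ≫ snd _ _ ≫ proj 𝔸 B B =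
      proj 𝔸 A B ≫ 𝔸.tgt ≫ 𝔸.idm := by
    have : idHom B ≫ proj 𝔸 B B = B ≫ 𝔸.idm := homLift_proj _ _ _
    simp only [Category.assoc, whiskerLeft_snd_assoc, this]
    rw [← Category.assoc (proj 𝔸 A B), proj_tgt]
    simp
  have e : pullback.lift (proj 𝔸 A B) (proj 𝔸 A B ≫ 𝔸.tgt ≫ 𝔸.idm) h =
      proj 𝔸 A B ≫ pullback.lift (𝟙 _) (𝔸.tgt ≫ 𝔸.idm) (by simp [𝔸.idm_src]) := by
    apply pullback.hom_ext
    · rw [Category.assoc, pullback.lift_fst, pullback.lift_fst, Category.comp_id]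
    · rw [Category.assoc, pullback.lift_snd, pullback.lift_snd]
  have key := compHom_proj ((ρ_ (homObj 𝔸 A B)).inv ≫ homObj 𝔸 A B ◁ idHom B)
    (a := proj 𝔸 A B) (by simp) hb h
  rw [e, Category.assoc (proj 𝔸 A B), 𝔸.comp_id] at key
  simpa using key

lemma assoc_aux (A B C D : 𝟙_ V ⟶ 𝔸.obj) :
    (α_ (homObj 𝔸 A B) (homObj 𝔸 B C) (homObj 𝔸 C D)).inv ≫ compHom A B C ▷ _ ≫
      compHom A C D = homObj 𝔸 A B ◁ compHom B C D ≫ compHom A B D := by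
  apply hom_ext
  let X := homObj 𝔸 A B ⊗ homObj 𝔸 B C ⊗ homObj 𝔸 C D
  let a : X ⟶ homObj 𝔸 A B := fst _ _
  let b : X ⟶ homObj 𝔸 B C := snd _ _ ≫ fst _ _
  let c : X ⟶ homObj 𝔸 C D := snd _ _ ≫ snd _ _
  have hab := comp_eq_src a b
  have hbc := comp_eq_src b c
  have key := 𝔸.assoc (a ≫ proj 𝔸 A B) (b ≫ proj 𝔸 B C) (c ≫ proj 𝔸 C D) hab hbc
  have h₁ : lift a b ≫ compHom A B C ≫ proj 𝔸 A C = pullback.lift _ _ hab ≫ 𝔸.comp :=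
    compHom_proj (lift a b) (by simp) (by simp) hab
  have h₂ : lift b c ≫ compHom B C D ≫ proj 𝔸 B D = pullback.lift _ _ hbc ≫ 𝔸.comp :=
    compHom_proj (lift b c) (by simp) (by simp) hbc
  have l₁ : (α_ (homObj 𝔸 A B) (homObj 𝔸 B C) (homObj 𝔸 C D)).inv ≫ compHom A B C ▷ _ =
      lift (lift a b ≫ compHom A B C) c := by
    apply CartesianMonoidalCategory.hom_ext
    · simp only [Category.assoc, whiskerRight_fst, lift_fst]
      rw [← Category.assoc]
      congr 1
      apply CartesianMonoidalCategory.hom_ext <;> simp [a, b]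
    · simp [c]
  have l₂ : homObj 𝔸 A B ◁ compHom B C D = lift a (lift b c ≫ compHom B C D) := by
    apply CartesianMonoidalCategory.hom_ext
    · simp [a]
    · simp only [whiskerLeft_snd, lift_snd]
      congr 1
      apply CartesianMonoidalCategory.hom_ext <;> simp [b, c]
  have k₁ := compHom_proj (lift (lift a b ≫ compHom A B C) c)
    (a := pullback.lift _ _ hab ≫ 𝔸.comp) (b := c ≫ proj 𝔸 C D)
    (by rw [lift_fst_assoc, Category.assoc, h₁]) (by rw [lift_snd_assoc])
    (by rw [Category.assoc, 𝔸.comp_tgt, pullback.lift_snd_assoc, hbc])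
  have k₂ := compHom_proj (lift a (lift b c ≫ compHom B C D))
    (a := a ≫ proj 𝔸 A B) (b := pullback.lift _ _ hbc ≫ 𝔸.comp)
    (by rw [lift_fst_assoc]) (by rw [lift_snd_assoc, Category.assoc, h₂])
    (by rw [hab, Category.assoc (pullback.lift _ _ _), 𝔸.comp_src, pullback.lift_fst_assoc])
  rw [← Category.assoc, l₁, l₂, Category.assoc, Category.assoc, k₁, k₂, key]

/-- The underlying `V`-category of an internal category to `V`. -/
instance : EnrichedCategory V (Und 𝔸) where
  Hom A B := homObj 𝔸 A B
  id A := idHom A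
  comp A B C := compHom A B C
  id_comp A B := id_comp_aux A B
  comp_id A B := comp_id_aux A B
  assoc A B C D := assoc_aux A B C D

end Und

end Underlying
section Enriched

variable {V : Type u} [Category.{v} V] [CartesianMonoidalCategory V]

section Cat

variable {C : Type w} [EnrichedCategory V C]

/-- Composition of generalized elements of hom-objects, in diagrammatic order. -/
abbrev eMul {A B D : C} {Y : V} (f : Y ⟶ (A ⟶[V] B)) (g : Y ⟶ (B ⟶[V] D)) : Y ⟶ (A ⟶[V] D) :=
  lift f g ≫ eComp V A B D

/-- The identity as a generalized element. -/
abbrev eOne (Y : V) (A : C) : Y ⟶ (A ⟶[V] A) := toUnit Y ≫ eId V A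

lemma comp_eMul {A B D : C} {Y Y' : V} (h : Y' ⟶ Y) (f : Y ⟶ (A ⟶[V] B)) (g : Y ⟶ (B ⟶[V] D)) :
    h ≫ eMul f g = eMul (h ≫ f) (h ≫ g) := by
  rw [comp_lift_assoc]

lemma eOne_eMul {A B : C} {Y : V} (f : Y ⟶ (A ⟶[V] B)) : eMul (eOne Y A) f = f := by
  have h := f ≫= e_id_comp V A B
  rw [Category.comp_id] at h
  refine Eq.trans ?_ h
  rw [eMul, ← Category.assoc, ← Category.assoc]
  congr 1
  apply CartesianMonoidalCategory.hom_ext <;> simp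

lemma eMul_eOne {A B : C} {Y : V} (f : Y ⟶ (A ⟶[V] B)) : eMul f (eOne Y B) = f := by
  have h := f ≫= e_comp_id V A B
  rw [Category.comp_id] at h
  refine Eq.trans ?_ h
  rw [eMul, ← Category.assoc, ← Category.assoc]
  congr 1
  apply CartesianMonoidalCategory.hom_ext <;> simp

lemma eMul_assoc {A B D E : C} {Y : V} (f : Y ⟶ (A ⟶[V] B)) (g : Y ⟶ (B ⟶[V] D))
    (h : Y ⟶ (D ⟶[V] E)) : eMul (eMul f g) h = eMul f (eMul g h) := by
  have k := lift f (lift g h) ≫= e_assoc V A B D E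
  have h₁ : lift f (lift g h) ≫ (α_ _ _ _).inv ≫ eComp V A B D ▷ _ = lift (eMul f g) h := by
    apply CartesianMonoidalCategory.hom_ext
    · simp
    · simp
  have h₂ : lift f (lift g h) ≫ _ ◁ eComp V B D E = lift f (eMul g h) := by
    apply CartesianMonoidalCategory.hom_ext <;> simp
  rw [eMul, ← h₁, eMul, ← h₂, Category.assoc, Category.assoc, Category.assoc]
  exact k

end Cat

variable [MonoidalClosed V]

/-- Evaluation of generalized elements of an internal hom. -/
abbrev hApp {X Z Y : V} (x : Y ⟶ X) (g : Y ⟶ (ihom X).obj Z) : Y ⟶ Z :=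
  lift x g ≫ (ihom.ev X).app Z

lemma comp_hApp {X Z Y Y' : V} (k : Y' ⟶ Y) (x : Y ⟶ X) (g : Y ⟶ (ihom X).obj Z) :
    k ≫ hApp x g = hApp (k ≫ x) (k ≫ g) := by
  rw [comp_lift_assoc]

lemma ihom_hom_ext {X Z Y : V} {g h : Y ⟶ (ihom X).obj Z}
    (H : hApp (fst X Y) (snd X Y ≫ g) = hApp (fst X Y) (snd X Y ≫ h)) : g = h := by
  apply MonoidalClosed.uncurry_injective
  have e : ∀ k : Y ⟶ (ihom X).obj Z, MonoidalClosed.uncurry k = hApp (fst X Y) (snd X Y ≫ k) :=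
    fun k => by
      rw [MonoidalClosed.uncurry_eq]
      congr 1
      apply CartesianMonoidalCategory.hom_ext <;> simp
  rw [e, e, H]

lemma hApp_curry {X Z Y Y' : V} (x : Y' ⟶ X) (k : Y' ⟶ Y) (g : X ⊗ Y ⟶ Z) :
    hApp x (k ≫ MonoidalClosed.curry g) = lift x k ≫ g := by
  have h : lift x (k ≫ MonoidalClosed.curry g) = lift x k ≫ X ◁ MonoidalClosed.curry g := by
    apply CartesianMonoidalCategory.hom_ext <;> simp
  rw [hApp, h, Category.assoc, ← MonoidalClosed.uncurry_eq, MonoidalClosed.uncurry_curry]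

lemma hApp_eOne {X Y : V} (x : Y ⟶ X) : hApp x (eOne Y X) = x := by
  change hApp x (toUnit Y ≫ MonoidalClosed.id X) = x
  rw [MonoidalClosed.id_eq, hApp_curry]
  simp

lemma hApp_eMul {X Y Z T : V} (x : T ⟶ X) (g : T ⟶ (ihom X).obj Y) (h : T ⟶ (ihom Y).obj Z) :
    hApp x (eMul (C := V) (A := X) (B := Y) (D := Z) g h) = hApp (hApp x g) h := by
  change hApp x (lift g h ≫ MonoidalClosed.comp X Y Z) = _
  rw [MonoidalClosed.comp_eq, hApp_curry, MonoidalClosed.compTranspose_eq, ← Category.assoc,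
    ← Category.assoc]
  congr 1
  apply CartesianMonoidalCategory.hom_ext
  · simp
  · simp

section Functor

variable [BraidedCategory V] {C : Type w} [EnrichedCategory V C] (F : EnrichedFunctor V Cᵒᵖ V)

/-- The evaluation `C(A, B) × F B ⟶ F A` of a contravariant `V`-functor, i.e. the transpose of
its action `C(A, B) ⟶ [F B, F A]` on hom-objects. -/
def ev (A B : C) : (A ⟶[V] B) ⊗ F.obj (op B) ⟶ F.obj (op A) :=
  (β_ _ _).hom ≫ MonoidalClosed.uncurry (F.map (op B) (op A))

/-- Evaluation of generalized elements. -/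
abbrev eAct {A B : C} {Y : V} (f : Y ⟶ (A ⟶[V] B)) (z : Y ⟶ F.obj (op B)) : Y ⟶ F.obj (op A) :=
  lift f z ≫ ev F A B

lemma comp_eAct {A B : C} {Y Y' : V} (h : Y' ⟶ Y) (f : Y ⟶ (A ⟶[V] B))
    (z : Y ⟶ F.obj (op B)) : h ≫ eAct F f z = eAct F (h ≫ f) (h ≫ z) := by
  rw [comp_lift_assoc]

lemma eAct_eq {A B : C} {Y : V} (f : Y ⟶ (A ⟶[V] B)) (z : Y ⟶ F.obj (op B)) :
    eAct F f z = hApp z (f ≫ F.map (op B) (op A)) := by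
  rw [eAct, ev, lift_braiding_hom_assoc, MonoidalClosed.uncurry_eq, ← Category.assoc]
  congr 1
  apply CartesianMonoidalCategory.hom_ext
  · simp
  · rw [Category.assoc, whiskerLeft_snd, lift_snd_assoc, lift_snd]

lemma eOne_eAct {A : C} {Y : V} (z : Y ⟶ F.obj (op A)) : eAct F (eOne Y A) z = z := by
  have h : eOne Y A ≫ F.map (op A) (op A) =
      eOne (C := V) Y (F.obj (op A)) := by
    have := F.map_id (op A)
    rw [eOne, Category.assoc]
    exact congrArg (fun t => toUnit Y ≫ t) this
  rw [eAct_eq, h, hApp_eOne]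

lemma eMul_eAct {A B D : C} {Y : V} (f : Y ⟶ (A ⟶[V] B)) (g : Y ⟶ (B ⟶[V] D))
    (z : Y ⟶ F.obj (op D)) : eAct F (eMul f g) z = eAct F f (eAct F g z) := by
  have h : eMul f g ≫ F.map (op D) (op A) =
      eMul (C := V) (A := F.obj (op D)) (B := F.obj (op B)) (D := F.obj (op A))
        (g ≫ F.map (op D) (op B))
        (f ≫ F.map (op B) (op A)) := by
    have h₁ : eMul f g = eMul (C := Cᵒᵖ) (A := op D) (B := op B) (D := op A) g f := by
      change _ = lift g f ≫ (β_ _ _).hom ≫ eComp V A B D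
      rw [lift_braiding_hom_assoc]
    rw [h₁, eMul, Category.assoc, F.map_comp, ← Category.assoc]
    congr 1
    apply CartesianMonoidalCategory.hom_ext
    · rw [Category.assoc, tensorHom_fst, lift_fst_assoc, lift_fst]
    · rw [Category.assoc, tensorHom_snd, lift_snd_assoc, lift_snd]
  rw [eAct_eq, eAct_eq, eAct_eq, h, hApp_eMul]

lemma eAct_fst_snd {A B : C} {Y : V} (k : Y ⟶ (A ⟶[V] B) ⊗ F.obj (op B)) :
    eAct F (k ≫ fst _ _) (k ≫ snd _ _) = k ≫ ev F A B := by
  rw [eAct, ← comp_lift, lift_fst_snd, Category.comp_id]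

end Functor

end Enriched
section Elements

/-- The pullback square of `f : Z ⟶ Y` along the projection `X ⊗ Y ⟶ Y`. -/
lemma isPullback_whiskerLeft {V : Type u} [Category.{v} V] [CartesianMonoidalCategory V]
    (X : V) {Z Y : V} (f : Z ⟶ Y) : IsPullback (X ◁ f) (snd X Z) (snd X Y) f := by
  refine ⟨⟨whiskerLeft_snd _ _⟩, ⟨PullbackCone.IsLimit.mk _
    (fun s => lift (s.fst ≫ fst X Y) s.snd) (fun s => ?_) (fun s => ?_) (fun s m h₁ h₂ => ?_)⟩⟩
  · apply CartesianMonoidalCategory.hom_ext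
    · simp
    · simp [s.condition]
  · simp
  · apply CartesianMonoidalCategory.hom_ext
    · simp [← h₁]
    · simp [← h₂]

variable {V : Type u} [Category.{v} V] [CartesianMonoidalCategory V] [BraidedCategory V]
  [MonoidalClosed V] [HasCoproducts.{w} V] {C : Type w} [EnrichedCategory V C]
  (F : EnrichedFunctor V Cᵒᵖ V)

/-- The object of objects of the category of elements: `∐ A, F A`. -/
abbrev elObj : V := ∐ fun A : C => F.obj (op A)

/-- The object of morphisms of the category of elements: `∐ (A, B), C(A, B) × F B`. -/
abbrev elMor : V := ∐ fun p : C × C => (p.1 ⟶[V] p.2) ⊗ F.obj (op p.2)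

abbrev elObjι (A : C) : F.obj (op A) ⟶ elObj F := Sigma.ι (fun A : C => F.obj (op A)) A

abbrev elMorι (A B : C) : (A ⟶[V] B) ⊗ F.obj (op B) ⟶ elMor F :=
  Sigma.ι (fun p : C × C => (p.1 ⟶[V] p.2) ⊗ F.obj (op p.2)) (A, B)

/-- The source map, on the summand at `(A, B)` the evaluation `C(A, B) × F B ⟶ F A`. -/
def elSrc : elMor F ⟶ elObj F := Sigma.desc fun p => ev F p.1 p.2 ≫ elObjι F p.1

/-- The target map, on the summand at `(A, B)` the projection `C(A, B) × F B ⟶ F B`. -/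
def elTgt : elMor F ⟶ elObj F := Sigma.desc fun p => snd _ _ ≫ elObjι F p.2

/-- The identity map, on the summand at `A` given by the identity of `A`. -/
def elIdm : elObj F ⟶ elMor F := Sigma.desc fun A => lift (eOne _ A) (𝟙 _) ≫ elMorι F A A

@[simp]
lemma ι_elSrc (A B : C) : elMorι F A B ≫ elSrc F = ev F A B ≫ elObjι F A := Sigma.ι_desc _ _

@[simp]
lemma ι_elSrc_assoc (A B : C) {T : V} (k : elObj F ⟶ T) :
    elMorι F A B ≫ elSrc F ≫ k =
      ev F A B ≫ elObjι F A ≫ k := by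
  have h := congrArg (fun t => t ≫ k) (ι_elSrc F A B)
  simpa only [Category.assoc] using h

@[simp]
lemma ι_elTgt (A B : C) : elMorι F A B ≫ elTgt F = snd _ _ ≫ elObjι F B := Sigma.ι_desc _ _

@[simp]
lemma ι_elTgt_assoc (A B : C) {T : V} (k : elObj F ⟶ T) :
    elMorι F A B ≫ elTgt F ≫ k =
      snd _ _ ≫ elObjι F B ≫ k := by
  have h := congrArg (fun t => t ≫ k) (ι_elTgt F A B)
  simpa only [Category.assoc] using h

@[simp]
lemma ι_elIdm (A : C) :
    elObjι F A ≫ elIdm F = lift (eOne _ A) (𝟙 _) ≫ elMorι F A A := Sigma.ι_desc _ _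

@[simp]
lemma ι_elIdm_assoc (A : C) {T : V} (k : elMor F ⟶ T) :
    elObjι F A ≫ elIdm F ≫ k =
      lift (eOne _ A) (𝟙 _) ≫ elMorι F A A ≫ k := by
  have h := congrArg (fun t => t ≫ k) (ι_elIdm F A)
  simpa only [Category.assoc] using h

lemma elIdm_src : elIdm F ≫ elSrc F = 𝟙 _ := by
  apply Limits.Sigma.hom_ext
  intro A
  have h : lift (eOne _ A) (𝟙 _) ≫ ev F A A = _ := eOne_eAct F (𝟙 (F.obj (op A)))
  rw [ι_elIdm_assoc, ι_elSrc, ← Category.assoc, h, Category.id_comp, Category.comp_id]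

lemma elIdm_tgt : elIdm F ≫ elTgt F = 𝟙 _ := by
  apply Limits.Sigma.hom_ext
  intro A
  rw [ι_elIdm_assoc, ι_elTgt, lift_snd_assoc, Category.id_comp, Category.comp_id]

variable [HasPullbacks V]

/-- The inclusion of the summand `C(A, B) × C(B, D) × F D` of the object of composable pairs. -/
def elPairι (A B D : C) :
    (A ⟶[V] B) ⊗ ((B ⟶[V] D) ⊗ F.obj (op D)) ⟶ pullback (elTgt F) (elSrc F) :=
  pullback.lift ((A ⟶[V] B) ◁ ev F B D ≫ elMorι F A B) (snd _ _ ≫ elMorι F B D) (by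
    rw [Category.assoc, Category.assoc, ι_elTgt, ι_elSrc, whiskerLeft_snd_assoc])

@[simp]
lemma elPairι_fst (A B D : C) : elPairι F A B D ≫ pullback.fst _ _ =
    (A ⟶[V] B) ◁ ev F B D ≫ elMorι F A B := pullback.lift_fst _ _ _

@[simp]
lemma elPairι_fst_assoc (A B D : C) {T : V} (k : elMor F ⟶ T) :
    elPairι F A B D ≫ pullback.fst _ _ ≫ k =
      (A ⟶[V] B) ◁ ev F B D ≫ elMorι F A B ≫ k := by
  have h := congrArg (fun t => t ≫ k) (elPairι_fst F A B D)
  simpa only [Category.assoc] using h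

@[simp]
lemma elPairι_snd (A B D : C) : elPairι F A B D ≫ pullback.snd _ _ =
    snd _ _ ≫ elMorι F B D := pullback.lift_snd _ _ _

@[simp]
lemma elPairι_snd_assoc (A B D : C) {T : V} (k : elMor F ⟶ T) :
    elPairι F A B D ≫ pullback.snd _ _ ≫ k =
      snd _ _ ≫ elMorι F B D ≫ k := by
  have h := congrArg (fun t => t ≫ k) (elPairι_snd F A B D)
  simpa only [Category.assoc] using h

variable [IsExtensive.{w} V]

/-- By extensivity, the object of composable pairs is `∐ (A, B, D), C(A, B) × C(B, D) × F D`. -/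
lemma isColimit_elPair : Nonempty (IsColimit (Cofan.mk (pullback (elTgt F) (elSrc F))
    fun q : C × (C × C) => elPairι F q.1 q.2.1 q.2.2)) :=
  isColimit_fiberProduct (I := C) (K := C) (J := C × C)
    (fun p => elMorι F p.1 p.2) (coproductIsCoproduct _)
    (fun A => elObjι F A) (coproductIsCoproduct _)
    (elTgt F) (fun _ _ => snd _ _) (fun A B => ι_elTgt F A B) Prod.fst
    (fun p => elMorι F p.1 p.2) (coproductIsCoproduct _)
    (elSrc F) (fun p => ev F p.1 p.2) (fun p => ι_elSrc F p.1 p.2)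
    (fun A p => (A ⟶[V] p.1) ◁ ev F p.1 p.2) (fun _ _ => snd _ _)
    (fun _ _ => isPullback_whiskerLeft _ _)
    (pullback.fst _ _) (pullback.snd _ _) (IsPullback.of_hasPullback _ _)
    (fun q => elPairι F q.1 q.2.1 q.2.2)
    (fun A p => elPairι_fst F A p.1 p.2) (fun A p => elPairι_snd F A p.1 p.2)

/-- The composition map, on the summand at `(A, B, D)` given by the composition of `C`. -/
def elComp : pullback (elTgt F) (elSrc F) ⟶ elMor F :=
  Cofan.IsColimit.desc (isColimit_elPair F).some fun q =>
    lift (eMul (fst _ _) (snd _ _ ≫ fst _ _)) (snd _ _ ≫ snd _ _) ≫ elMorι F q.1 q.2.2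

lemma elPairι_elComp (A B D : C) : elPairι F A B D ≫ elComp F =
    lift (eMul (fst _ _) (snd _ _ ≫ fst _ _)) (snd _ _ ≫ snd _ _) ≫ elMorι F A D :=
  Cofan.IsColimit.fac (isColimit_elPair F).some _ (A, (B, D))

lemma elPair_hom_ext {T : V} {f g : pullback (elTgt F) (elSrc F) ⟶ T}
    (h : ∀ A B D, elPairι F A B D ≫ f = elPairι F A B D ≫ g) : f = g :=
  Cofan.IsColimit.hom_ext (isColimit_elPair F).some _ _ fun q => h q.1 q.2.1 q.2.2

/-- Composition of generalized morphisms in the category of elements. -/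
lemma lift_elComp {A B D : C} {Y : V} (a : Y ⟶ (A ⟶[V] B)) (b : Y ⟶ (B ⟶[V] D))
    (z : Y ⟶ F.obj (op D)) {f g : Y ⟶ elMor F} (hf : f = lift a (eAct F b z) ≫ elMorι F A B)
    (hg : g = lift b z ≫ elMorι F B D) (h : f ≫ elTgt F = g ≫ elSrc F) :
    pullback.lift f g h ≫ elComp F = lift (eMul a b) z ≫ elMorι F A D := by
  subst hf hg
  have e : pullback.lift _ _ h = lift a (lift b z) ≫ elPairι F A B D := by
    apply pullback.hom_ext
    · rw [pullback.lift_fst, Category.assoc, elPairι_fst, lift_whiskerLeft_assoc]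
    · rw [pullback.lift_snd, Category.assoc, elPairι_snd, lift_snd_assoc]
  rw [e, Category.assoc, elPairι_elComp, ← Category.assoc]
  congr 1
  apply CartesianMonoidalCategory.hom_ext
  · rw [Category.assoc, lift_fst, lift_fst, comp_eMul]
    simp
  · simp

lemma elComp_src : elComp F ≫ elSrc F = pullback.fst _ _ ≫ elSrc F := by
  apply elPair_hom_ext
  intro A B D
  have h : lift (eMul (fst _ _) (snd _ _ ≫ fst _ _)) (snd _ _ ≫ snd _ _) ≫ ev F A D = _ :=
    eMul_eAct F (fst (A ⟶[V] B) ((B ⟶[V] D) ⊗ F.obj (op D))) (snd _ _ ≫ fst _ _)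
      (snd _ _ ≫ snd _ _)
  rw [← Category.assoc, elPairι_elComp, elPairι_fst_assoc, Category.assoc, ι_elSrc, ι_elSrc,
    ← Category.assoc, h, ← Category.assoc]
  congr 1
  rw [eAct]
  congr 1
  apply CartesianMonoidalCategory.hom_ext
  · simp
  · rw [lift_snd, whiskerLeft_snd, eAct, ← comp_lift, lift_fst_snd, Category.comp_id]

lemma elComp_tgt : elComp F ≫ elTgt F = pullback.snd _ _ ≫ elTgt F := by
  apply elPair_hom_ext
  intro A B D
  rw [← Category.assoc, elPairι_elComp, elPairι_snd_assoc, Category.assoc, ι_elTgt, ι_elTgt,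
    lift_snd_assoc, Category.assoc]

lemma el_id_comp (h) : pullback.lift (elSrc F ≫ elIdm F) (𝟙 (elMor F)) h ≫ elComp F = 𝟙 _ := by
  apply Limits.Sigma.hom_ext
  rintro ⟨A, B⟩
  have e : elMorι F A B ≫ pullback.lift (elSrc F ≫ elIdm F) (𝟙 (elMor F)) h =
      pullback.lift (elMorι F A B ≫ elSrc F ≫ elIdm F) (elMorι F A B ≫ 𝟙 _)
        (by rw [Category.assoc, h, Category.assoc]) := by
    apply pullback.hom_ext
    · rw [Category.assoc, pullback.lift_fst, pullback.lift_fst]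
    · rw [Category.assoc, pullback.lift_snd, pullback.lift_snd]
  rw [← Category.assoc, e, lift_elComp F (eOne _ A) (fst _ _) (snd _ _), eOne_eMul]
  · simp
  · rw [ι_elSrc_assoc, ι_elIdm, comp_lift_assoc]
    congr 2
    · simp
    · rw [eAct, lift_fst_snd, Category.id_comp, Category.comp_id]
  · simp

lemma el_comp_id (h) : pullback.lift (𝟙 (elMor F)) (elTgt F ≫ elIdm F) h ≫ elComp F = 𝟙 _ := by
  apply Limits.Sigma.hom_ext
  rintro ⟨A, B⟩
  have e : elMorι F A B ≫ pullback.lift (𝟙 (elMor F)) (elTgt F ≫ elIdm F) h =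
      pullback.lift (elMorι F A B ≫ 𝟙 _) (elMorι F A B ≫ elTgt F ≫ elIdm F)
        (by rw [Category.assoc, h, Category.assoc, Category.assoc, Category.assoc]) := by
    apply pullback.hom_ext
    · rw [Category.assoc, pullback.lift_fst, pullback.lift_fst]
    · rw [Category.assoc, pullback.lift_snd, pullback.lift_snd]
  rw [← Category.assoc, e, lift_elComp F (fst _ _) (eOne _ B) (snd _ _), eMul_eOne]
  · simp
  · rw [eOne_eAct]
    simp
  · rw [ι_elTgt_assoc, ι_elIdm, comp_lift_assoc]
    congr 2
    · simp
    · simp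

lemma comp_pullback_lift {V : Type u} [Category.{v} V] [HasPullbacks V] {A B D Y Y' : V}
    {t : A ⟶ D} {s : B ⟶ D} (k : Y' ⟶ Y) (f : Y ⟶ A) (g : Y ⟶ B) (h : f ≫ t = g ≫ s) :
    k ≫ pullback.lift f g h = pullback.lift (k ≫ f) (k ≫ g)
      (by rw [Category.assoc, h, Category.assoc]) := by
  apply pullback.hom_ext
  · rw [Category.assoc, pullback.lift_fst, pullback.lift_fst]
  · rw [Category.assoc, pullback.lift_snd, pullback.lift_snd]

lemma el_assoc_aux {A B D E : C} {Y : V} (a : Y ⟶ (A ⟶[V] B)) (b : Y ⟶ (B ⟶[V] D))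
    (c : Y ⟶ (D ⟶[V] E)) (z : Y ⟶ F.obj (op E)) {f g h : Y ⟶ elMor F}
    (hf : f = lift a (eAct F b (eAct F c z)) ≫ elMorι F A B)
    (hg : g = lift b (eAct F c z) ≫ elMorι F B D) (hh : h = lift c z ≫ elMorι F D E)
    (hfg : f ≫ elTgt F = g ≫ elSrc F) (hgh : g ≫ elTgt F = h ≫ elSrc F) (h₁ h₂) :
    pullback.lift (pullback.lift f g hfg ≫ elComp F) h h₁ ≫ elComp F =
      pullback.lift f (pullback.lift g h hgh ≫ elComp F) h₂ ≫ elComp F := by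
  rw [lift_elComp F (eMul a b) c z (lift_elComp F a b (eAct F c z) hf hg hfg) hh,
    lift_elComp F a (eMul b c) z (by rw [eMul_eAct, hf]) (lift_elComp F b c z hg hh hgh),
    eMul_assoc]

lemma el_assoc {Y : V} (f g h : Y ⟶ elMor F) (hfg : f ≫ elTgt F = g ≫ elSrc F)
    (hgh : g ≫ elTgt F = h ≫ elSrc F) (h₁ h₂) :
    pullback.lift (pullback.lift f g hfg ≫ elComp F) h h₁ ≫ elComp F =
      pullback.lift f (pullback.lift g h hgh ≫ elComp F) h₂ ≫ elComp F := by
  let s : pullback (elTgt F) (elSrc F) ⟶ elObj F := pullback.fst _ _ ≫ elSrc F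
  let T : V := pullback (elTgt F) s
  let t : ∀ q : C × (C × (C × C)), (q.1 ⟶[V] q.2.1) ⊗ ((q.2.1 ⟶[V] q.2.2.1) ⊗
      ((q.2.2.1 ⟶[V] q.2.2.2) ⊗ F.obj (op q.2.2.2))) ⟶ T := fun q =>
    pullback.lift (_ ◁ (_ ◁ ev F _ _ ≫ ev F _ _) ≫ elMorι F _ _) (snd _ _ ≫ elPairι F _ _ _) (by
      simp [s])
  have ht₁ : ∀ q, t q ≫ pullback.fst _ _ = _ := fun q => pullback.lift_fst _ _ _
  have ht₂ : ∀ q, t q ≫ pullback.snd _ _ = _ := fun q => pullback.lift_snd _ _ _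
  obtain ⟨hT⟩ : Nonempty (IsColimit (Cofan.mk T t)) :=
    isColimit_fiberProduct (I := C) (K := C) (J := C × (C × C))
      (fun p => elMorι F p.1 p.2) (coproductIsCoproduct _)
      (fun A => elObjι F A) (coproductIsCoproduct _)
      (elTgt F) (fun _ _ => snd _ _) (fun A B => ι_elTgt F A B) Prod.fst
      (fun q => elPairι F q.1 q.2.1 q.2.2) (isColimit_elPair F).some
      s (fun q => _ ◁ ev F q.2.1 q.2.2 ≫ ev F q.1 q.2.1) (fun q => by simp [s])
      (fun A q => (A ⟶[V] q.1) ◁ (_ ◁ ev F q.2.1 q.2.2 ≫ ev F q.1 q.2.1)) (fun _ _ => snd _ _)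
      (fun _ _ => isPullback_whiskerLeft _ _)
      (pullback.fst _ _) (pullback.snd _ _) (IsPullback.of_hasPullback _ _)
      t (fun A q => ht₁ (A, q)) (fun A q => ht₂ (A, q))
  let f' : T ⟶ elMor F := pullback.fst _ _
  let g' : T ⟶ elMor F := pullback.snd _ _ ≫ pullback.fst _ _
  let h' : T ⟶ elMor F := pullback.snd _ _ ≫ pullback.snd _ _
  have hfg' : f' ≫ elTgt F = g' ≫ elSrc F := by
    rw [pullback.condition, Category.assoc]
  have hgh' : g' ≫ elTgt F = h' ≫ elSrc F := by
    rw [Category.assoc, pullback.condition, Category.assoc]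
  have key : pullback.lift (pullback.lift f' g' hfg' ≫ elComp F) h'
        (by rw [Category.assoc, elComp_tgt, pullback.lift_snd_assoc, hgh']) ≫ elComp F =
      pullback.lift f' (pullback.lift g' h' hgh' ≫ elComp F)
        (by rw [Category.assoc, elComp_src, pullback.lift_fst_assoc, hfg']) ≫ elComp F := by
    apply Cofan.IsColimit.hom_ext hT
    rintro ⟨A, B, D, E⟩
    change t (A, B, D, E) ≫ _ = t (A, B, D, E) ≫ _
    simp only [← Category.assoc, comp_pullback_lift]
    apply el_assoc_aux F (fst _ _) (snd _ _ ≫ fst _ _) (snd _ _ ≫ snd _ _ ≫ fst _ _)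
      (snd _ _ ≫ snd _ _ ≫ snd _ _)
    · rw [ht₁]
      congr 1
      apply CartesianMonoidalCategory.hom_ext
      · rw [whiskerLeft_fst, lift_fst]
      · rw [whiskerLeft_snd, lift_snd]
        simp only [← Category.assoc, eAct_fst_snd]
        rw [← eAct_fst_snd]
        simp
    · rw [← Category.assoc, ht₂, Category.assoc, elPairι_fst, ← Category.assoc]
      congr 1
      apply CartesianMonoidalCategory.hom_ext
      · simp
      · rw [lift_snd]
        simp only [← Category.assoc, eAct_fst_snd]
        simp
    · rw [← Category.assoc, ht₂, Category.assoc, elPairι_snd, ← Category.assoc]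
      congr 1
      apply CartesianMonoidalCategory.hom_ext
      · simp
      · simp
  let u : Y ⟶ T := pullback.lift f (pullback.lift g h hgh) (by
    rw [pullback.lift_fst_assoc, hfg])
  have hf : u ≫ f' = f := pullback.lift_fst _ _ _
  have hg : u ≫ g' = g := by
    rw [← Category.assoc, pullback.lift_snd, pullback.lift_fst]
  have hh : u ≫ h' = h := by
    rw [← Category.assoc, pullback.lift_snd, pullback.lift_snd]
  have key' := u ≫= key
  simp only [← Category.assoc, comp_pullback_lift] at key'
  simpa only [hf, hg, hh] using key'

/-- The category of elements of a contravariant `V`-functor, as an internal category to `V`. -/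
def elements : InternalCategory V where
  obj := elObj F
  mor := elMor F
  src := elSrc F
  tgt := elTgt F
  idm := elIdm F
  comp := elComp F
  idm_src := elIdm_src F
  idm_tgt := elIdm_tgt F
  comp_src := elComp_src F
  comp_tgt := elComp_tgt F
  id_comp := el_id_comp F _
  comp_id := el_comp_id F _
  assoc f g h hfg hgh := el_assoc F f g h hfg hgh _ _

/-- A global element `x` of `F c` as an object `(c, x)` of the underlying `V`-category of the
category of elements. -/
def elMk (c : C) (x : 𝟙_ V ⟶ F.obj (op c)) : Und (elements F) := x ≫ elObjι F c

end Elements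
section NatTrans

variable {V : Type u} [Category.{v} V] [CartesianMonoidalCategory V]
  {C : Type*} [EnrichedCategory V C] {D : Type*} [EnrichedCategory V D]

/-- A `V`-natural transformation: a family of elements `α A : * ⟶ D(F A, G A)` such that the two
composites `C(A, B) ⟶ D(F A, G B)`, namely `F` followed by postcomposition with `α B` and `G`
followed by precomposition with `α A`, agree. -/
structure VNatTrans (F G : EnrichedFunctor V C D) where
  app (A : C) : 𝟙_ V ⟶ (F.obj A ⟶[V] G.obj A)
  naturality (A B : C) :
    eMul (F.map A B) (toUnit _ ≫ app B) = eMul (toUnit _ ≫ app A) (G.map A B)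

/-- `V`-natural isomorphisms: `V`-natural transformations with a `V`-natural inverse. -/
def VNatTrans.IsIso {F G : EnrichedFunctor V C D} (α : VNatTrans F G) : Prop :=
  ∃ β : VNatTrans G F, ∀ A : C,
    eMul (α.app A) (β.app A) = eId V (F.obj A) ∧ eMul (β.app A) (α.app A) = eId V (G.obj A)

/-- A `V`-terminal object: all hom-objects into it are terminal. -/
def IsVTerminal (V : Type u) [Category.{v} V] [CartesianMonoidalCategory V]
    {D : Type*} [EnrichedCategory V D] (T : D) : Prop :=
  ∀ A : D, CategoryTheory.IsIso (toUnit (A ⟶[V] T))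

/-- A family of objects such that a map `f` is invertible if and only if postcomposition with `f`
is bijective on maps out of every member of the family. -/
def IsConservativeFamily {V : Type u} [Category.{v} V] (G : Set V) : Prop :=
  ∀ ⦃Y Z : V⦄ (f : Y ⟶ Z),
    CategoryTheory.IsIso f ↔ ∀ X ∈ G, Function.Bijective fun g : X ⟶ Y => g ≫ f

end NatTrans

section Representable

variable {V : Type u} [Category.{v} V] [CartesianMonoidalCategory V] [BraidedCategory V]
  [MonoidalClosed V] {C : Type w} [EnrichedCategory V C]

/-- The action `C(A, B) ⟶ [C(B, c), C(A, c)]` of the representable `V`-functor. -/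
def repMap (c A B : C) : (A ⟶[V] B) ⟶ (ihom (B ⟶[V] c)).obj (A ⟶[V] c) :=
  MonoidalClosed.curry ((β_ _ _).hom ≫ eComp V A B c)

lemma hApp_repMap {c A B : C} {Y : V} (w : Y ⟶ (B ⟶[V] c)) (k : Y ⟶ (A ⟶[V] B)) :
    hApp w (k ≫ repMap c A B) = eMul k w := by
  rw [repMap, hApp_curry, lift_braiding_hom_assoc]

lemma repMap_id (c A : C) : eId V A ≫ repMap c A A = eId V (A ⟶[V] c) := by
  apply ihom_hom_ext
  rw [← Category.assoc, hApp_repMap, toUnit_unique (snd _ _) (toUnit _)]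
  exact (eOne_eMul _).trans (hApp_eOne _).symm

lemma repMap_comp (c A B D : C) :
    ((β_ (B ⟶[V] A) (D ⟶[V] B)).hom ≫ eComp V D B A) ≫ repMap c D A =
      (repMap c B A ⊗ₘ repMap c D B) ≫ eComp V (A ⟶[V] c) (B ⟶[V] c) (D ⟶[V] c) := by
  apply ihom_hom_ext
  let w := fst (A ⟶[V] c) ((B ⟶[V] A) ⊗ (D ⟶[V] B))
  let k : _ ⟶ (B ⟶[V] A) := snd (A ⟶[V] c) ((B ⟶[V] A) ⊗ (D ⟶[V] B)) ≫ fst _ _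
  let l : _ ⟶ (D ⟶[V] B) := snd (A ⟶[V] c) ((B ⟶[V] A) ⊗ (D ⟶[V] B)) ≫ snd _ _
  have h : snd (A ⟶[V] c) ((B ⟶[V] A) ⊗ (D ⟶[V] B)) = lift k l := by
    apply CartesianMonoidalCategory.hom_ext <;> simp [k, l]
  have h₁ : lift k l ≫ ((β_ (B ⟶[V] A) (D ⟶[V] B)).hom ≫ eComp V D B A) ≫ repMap c D A =
      eMul l k ≫ repMap c D A := by
    rw [Category.assoc, lift_braiding_hom_assoc, Category.assoc]
  have h₂ : lift k l ≫ (repMap c B A ⊗ₘ repMap c D B) ≫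
      eComp V (A ⟶[V] c) (B ⟶[V] c) (D ⟶[V] c) =
      eMul (C := V) (A := (A ⟶[V] c)) (B := (B ⟶[V] c)) (D := (D ⟶[V] c))
        (k ≫ repMap c B A) (l ≫ repMap c D B) := by
    rw [← Category.assoc, eMul]
    congr 1
    apply CartesianMonoidalCategory.hom_ext
    · rw [Category.assoc, tensorHom_fst, lift_fst_assoc]
      exact (lift_fst _ _).symm
    · rw [Category.assoc, tensorHom_snd, lift_snd_assoc]
      exact (lift_snd _ _).symm
  rw [h, h₁, h₂, hApp_eMul, hApp_repMap, hApp_repMap, hApp_repMap, eMul_assoc]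

variable (V) in
/-- The representable `V`-functor `C(-, c)`. -/
def rep (c : C) : EnrichedFunctor V Cᵒᵖ V where
  obj A := A.unop ⟶[V] c
  map A B := repMap c B.unop A.unop
  map_id A := repMap_id c A.unop
  map_comp A B D := repMap_comp c A.unop B.unop D.unop

lemma hApp_rep_map {c A B : C} {Y : V} (w : Y ⟶ (B ⟶[V] c)) (k : Y ⟶ (A ⟶[V] B)) :
    hApp w (k ≫ (rep V c).map (op B) (op A)) = eMul k w := hApp_repMap w k

variable (F : EnrichedFunctor V Cᵒᵖ V)

/-- The component at `A` of the `V`-natural transformation `C(-, c) ⟶ F` which corresponds to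
`x : * ⟶ F c`: the transpose of `C(A, c) ≅ C(A, c) × * ⟶ C(A, c) × F c ⟶ F A`. -/
def yonedaApp (c : C) (x : 𝟙_ V ⟶ F.obj (op c)) (A : C) :
    𝟙_ V ⟶ (ihom (A ⟶[V] c)).obj (F.obj (op A)) :=
  MonoidalClosed.curry ((A ⟶[V] c) ◁ x ≫ ev F A c)

lemma hApp_yonedaApp {c A : C} (x : 𝟙_ V ⟶ F.obj (op c)) {Y : V} (w : Y ⟶ (A ⟶[V] c)) :
    hApp w (toUnit Y ≫ yonedaApp F c x A) = eAct F w (toUnit Y ≫ x) := by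
  rw [yonedaApp, hApp_curry, lift_whiskerLeft_assoc]

lemma yonedaApp_naturality (c : C) (x : 𝟙_ V ⟶ F.obj (op c)) (A B : C) :
    eMul (C := V) (A := (A ⟶[V] c)) (B := (B ⟶[V] c)) (D := F.obj (op B)) (repMap c B A)
      (toUnit _ ≫ yonedaApp F c x B) =
    eMul (C := V) (A := (A ⟶[V] c)) (B := F.obj (op A)) (D := F.obj (op B))
      (toUnit (B ⟶[V] A) ≫ yonedaApp F c x A) (F.map (op A) (op B)) := by
  have e : ∀ (Y Z : V) (t : 𝟙_ V ⟶ Z),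
      snd Y (B ⟶[V] A) ≫ toUnit _ ≫ t = toUnit _ ≫ t := fun Y Z t => by
    rw [← Category.assoc, toUnit_unique (snd _ _ ≫ toUnit _) (toUnit _)]
  apply ihom_hom_ext
  rw [comp_eMul, comp_eMul, hApp_eMul, hApp_eMul]
  erw [e, e]
  rw [hApp_yonedaApp, hApp_yonedaApp, hApp_repMap, eMul_eAct]
  exact eAct_eq F _ _

/-- The `V`-natural transformation `C(-, c) ⟶ F` which corresponds to `x : * ⟶ F c` under the
Yoneda lemma. -/
def yonedaTrans (c : C) (x : 𝟙_ V ⟶ F.obj (op c)) : VNatTrans (rep V c) F where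
  app A := yonedaApp F c x A.unop
  naturality A B := yonedaApp_naturality F c x A.unop B.unop

/-- The element of `F c` corresponding to `yonedaTrans F c x`, i.e. the image of the identity
of `c`, is `x`. -/
lemma yonedaTrans_id (c : C) (x : 𝟙_ V ⟶ F.obj (op c)) :
    hApp (Z := F.obj (op c)) (eId V c) ((yonedaTrans F c x).app (op c)) = x := by
  have h := hApp_yonedaApp F x (eOne (𝟙_ V) c)
  rw [eOne_eAct, eOne, toUnit_unique (toUnit (𝟙_ V)) (𝟙 _), Category.id_comp, Category.id_comp,
    Category.id_comp] at h
  exact h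

/-- A `V`-natural transformation out of a representable is determined by its element. -/
lemma eq_yonedaTrans (c : C) (x : 𝟙_ V ⟶ F.obj (op c)) (α : VNatTrans (rep V c) F)
    (h : hApp (Z := F.obj (op c)) (eId V c) (α.app (op c)) = x) (A : C) :
    α.app (op A) = (yonedaTrans F c x).app (op A) := by
  have hext : ∀ g g' : 𝟙_ V ⟶ (ihom (A ⟶[V] c)).obj (F.obj (op A)),
      hApp (𝟙 _) (toUnit _ ≫ g) = hApp (𝟙 _) (toUnit _ ≫ g') → g = g' := fun g g' e => by
    apply ihom_hom_ext
    have e' := fst (A ⟶[V] c) (𝟙_ V) ≫= e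
    rw [comp_hApp, comp_hApp, Category.comp_id] at e'
    rw [toUnit_unique (snd (A ⟶[V] c) (𝟙_ V)) (fst _ _ ≫ toUnit _), Category.assoc,
      Category.assoc]
    exact e'
  let m : 𝟙_ V ⟶ (ihom (c ⟶[V] c)).obj (F.obj (op c)) := α.app (op c)
  let n : 𝟙_ V ⟶ (ihom (A ⟶[V] c)).obj (F.obj (op A)) := α.app (op A)
  have nat : eMul (C := V) (A := (c ⟶[V] c)) (B := (A ⟶[V] c)) (D := F.obj (op A)) (repMap c A c)
      (toUnit _ ≫ n) = eMul (C := V) (A := (c ⟶[V] c)) (B := F.obj (op c)) (D := F.obj (op A))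
      (toUnit (A ⟶[V] c) ≫ m) (F.map (op c) (op A)) := α.naturality (op c) (op A)
  have nat' := congrArg (hApp (eOne _ c)) nat
  have hm : hApp (eOne (A ⟶[V] c) c) (toUnit _ ≫ m) = toUnit _ ≫ x := by
    rw [← h]
    exact (comp_hApp (toUnit (A ⟶[V] c)) (eId V c) m).symm
  have hr := hApp_repMap (eOne (A ⟶[V] c) c) (𝟙 (A ⟶[V] c))
  rw [Category.id_comp, eMul_eOne] at hr
  have hF := eAct_eq F (𝟙 (A ⟶[V] c)) (toUnit _ ≫ x)
  rw [Category.id_comp] at hF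
  rw [hApp_eMul, hApp_eMul, hr, hm] at nat'
  apply hext
  exact nat'.trans (hF.symm.trans (hApp_yonedaApp F x (𝟙 _)).symm)

/-- A contravariant `V`-functor `F` is represented by `(c, x)` if the `V`-natural transformation
`C(-, c) ⟶ F` corresponding to `x` is a `V`-natural isomorphism. -/
def IsVRepresentable (c : C) (x : 𝟙_ V ⟶ F.obj (op c)) : Prop := (yonedaTrans F c x).IsIso

end Representable

section Tensors

variable {V : Type u} [Category.{v} V] [CartesianMonoidalCategory V] [MonoidalClosed V]

/-- A `V`-tensor of `c` by `X`: an object `c ⊗ X` with a map `γ : X ⟶ C(c, c ⊗ X)` such that the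
maps `C(c ⊗ X, A) ⟶ [X, C(c, A)]` induced by `γ` and composition are invertible. -/
structure VTensor {C : Type w} [EnrichedCategory V C] (c : C) (X : V) where
  obj : C
  γ : X ⟶ (c ⟶[V] obj)
  isIso (A : C) : CategoryTheory.IsIso
    (MonoidalClosed.curry (γ ▷ (obj ⟶[V] A) ≫ eComp V c obj A) :
      (obj ⟶[V] A) ⟶ (ihom X).obj (c ⟶[V] A))

/-- All `V`-tensors by `X` exist in `C`. -/
def HasTensorsBy (C : Type w) [EnrichedCategory V C] (X : V) : Prop :=
  ∀ c : C, Nonempty (VTensor c X)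

variable [BraidedCategory V] {C : Type w} [EnrichedCategory V C]

/-- A contravariant `V`-functor `F` preserves `V`-tensors by `X` if for every tensor `c ⊗ X` there
is an isomorphism `φ : [X, F c] ≅ F (c ⊗ X)` such that the composite of `γ × φ` with the evaluation
`C(c, c ⊗ X) × F (c ⊗ X) ⟶ F c` is the evaluation `X × [X, F c] ⟶ F c`. -/
def PreservesTensorsBy (F : EnrichedFunctor V Cᵒᵖ V) (X : V) : Prop :=
  ∀ (c : C) (T : VTensor c X), ∃ φ : (ihom X).obj (F.obj (op c)) ≅ F.obj (op T.obj),
    (T.γ ⊗ₘ φ.hom) ≫ ev F c T.obj = (ihom.ev X).app (F.obj (op c))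

end Tensors

end EnrichedRep

end

open EnrichedRep

/-!
For `x : * ⟶ F c` write `m A : C(A, c) ⟶ F A` for the map `f ↦ f · x`, called `act F x A` below.

Unwinding the transposes, `(c, x)` represents `F` exactly when every `m A` is invertible
(`isVRepresentable_iff`): the inverses of the `m A` are automatically `V`-natural, because the
`m A` are.

On the other side, the fibre of the target map of the category of elements over `(c, x)` is, by
extensivity, the coproduct `∐ A, C(A, c)`, and the source map restricts to `∐ A, m A` on it
(`isColimit_fiberι`, `fiberι_fiberSrc`). The hom-object from `a` to `(c, x)` in the underlying
`V`-category is therefore the fibre of `∐ A, m A` over `a` (`Und.isPullback_homObj`). If all `m A` are invertible, so is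
their coproduct, and its fibres are terminal.

Conversely, if these fibres are terminal, take `a = (A, y)`. Summands of a coproduct are pullbacks,
so every `y : * ⟶ F A` lifts uniquely through `m A`, which means that `V(*, m A)` is bijective for
all `A` (`bijective_of_isVTerminal`). A tensor `A ⊗ X` preserved by `F` identifies `V(X, m A)` with
`V(*, m (A ⊗ X))`, via
`V(X, C(A, c)) ≅ V(*, [X, C(A, c)]) ≅ V(*, C(A ⊗ X, c))` and
`V(X, F A) ≅ V(*, [X, F A]) ≅ V(*, F (A ⊗ X))` (`bijective_of_tensor`). Hence `V(X, m A)` is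
bijective for all `X` in the conservative family, and `m A` is invertible.
-/

noncomputable section

namespace EnrichedRep

/-! ### Elements of internal homs -/

section Internal

variable {V : Type u} [Category.{v} V] [CartesianMonoidalCategory V] [MonoidalClosed V]

/-- If `g` followed by `h` is the identity as an element of `[X, X]`, then it acts as the identity. -/
lemma hApp_hApp_of_eMul_eq_eId {X Y : V} (g : 𝟙_ V ⟶ (ihom X).obj Y) (h : 𝟙_ V ⟶ (ihom Y).obj X)
    (e : eMul (C := V) (A := X) (B := Y) (D := X) g h = eId V X) {T : V} (w : T ⟶ X) :
    hApp (hApp w (toUnit T ≫ g)) (toUnit T ≫ h) = w := by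
  have e' := congrArg (fun t => hApp w (toUnit T ≫ t)) e
  simp only [comp_eMul] at e'
  rw [hApp_eMul] at e'
  exact e'.trans (hApp_eOne w)

/-- The name `* ⟶ [X, Y]` of a map `X ⟶ Y`. -/
def homName {X Y : V} (f : X ⟶ Y) : 𝟙_ V ⟶ (ihom X).obj Y := MonoidalClosed.curry (fst _ _ ≫ f)

lemma hApp_homName {X Y T : V} (f : X ⟶ Y) (w : T ⟶ X) :
    hApp w (toUnit T ≫ homName f) = w ≫ f := by
  rw [homName, hApp_curry, lift_fst_assoc]

/-- Elements of an internal hom are equal if they act in the same way on generalized elements. -/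
lemma eq_of_hApp {X Y : V} {g h : 𝟙_ V ⟶ (ihom X).obj Y}
    (e : ∀ (T : V) (w : T ⟶ X), hApp w (toUnit T ≫ g) = hApp w (toUnit T ≫ h)) : g = h := by
  apply ihom_hom_ext
  rw [toUnit_unique (snd X (𝟙_ V)) (toUnit _)]
  exact e _ _

lemma eMul_eq_eId {X Y : V} (g : 𝟙_ V ⟶ (ihom X).obj Y) (h : 𝟙_ V ⟶ (ihom Y).obj X)
    (e : ∀ (T : V) (w : T ⟶ X), hApp (hApp w (toUnit T ≫ g)) (toUnit T ≫ h) = w) :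
    eMul (C := V) (A := X) (B := Y) (D := X) g h = eId V X := by
  apply eq_of_hApp
  intro T w
  rw [comp_eMul, hApp_eMul, e]
  exact (hApp_eOne w).symm

/-- Maps `X ⟶ C(A, c)` correspond to global elements of `C(A ⊗ X, c)`. -/
lemma VTensor.bijective {C : Type w} [EnrichedCategory V C] {A : C} {X : V} (T : VTensor A X)
    (c : C) :
    Function.Bijective fun h : 𝟙_ V ⟶ (T.obj ⟶[V] c) => eMul T.γ (toUnit X ≫ h) := by
  -- Both `κ` and the passage from a map to its name are invertible.
  have := T.isIso c
  let κ : (T.obj ⟶[V] c) ⟶ (ihom X).obj (A ⟶[V] c) :=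
    MonoidalClosed.curry (T.γ ▷ (T.obj ⟶[V] c) ≫ eComp V A T.obj c)
  have hκ : ∀ h : 𝟙_ V ⟶ (T.obj ⟶[V] c),
      eMul T.γ (toUnit X ≫ h) = hApp (𝟙 X) (toUnit X ≫ h ≫ κ) := fun h => by
    rw [← Category.assoc, hApp_curry, ← Category.assoc, eMul]
    congr 1
    apply CartesianMonoidalCategory.hom_ext <;> simp
  constructor
  · intro h h' e
    simp only [hκ] at e
    rw [← cancel_mono κ]
    apply eq_of_hApp
    intro T' w
    have e' := w ≫= e
    rwa [comp_hApp, comp_hApp, Category.comp_id, ← Category.assoc, ← Category.assoc w,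
      toUnit_unique (w ≫ toUnit _) (toUnit _)] at e'
  · intro f
    refine ⟨homName f ≫ inv κ, ?_⟩
    simp only [hκ, Category.assoc, IsIso.inv_hom_id, Category.comp_id]
    rw [hApp_homName, Category.id_comp]

end Internal

/-! ### Representability and tensors in terms of the maps `C(A, c) ⟶ F A` -/

section Act

variable {V : Type u} [Category.{v} V] [CartesianMonoidalCategory V] [BraidedCategory V]
  [MonoidalClosed V] {C : Type w} [EnrichedCategory V C] (F : EnrichedFunctor V Cᵒᵖ V)
  {c : C} (x : 𝟙_ V ⟶ F.obj (op c))

/-- The map `C(A, c) ⟶ F A`, `f ↦ f · x`, underlying the component at `A` of the transformation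
`C(-, c) ⟶ F` that corresponds to `x`. -/
def act (A : C) : (A ⟶[V] c) ⟶ F.obj (op A) := eAct F (𝟙 _) (toUnit _ ≫ x)

lemma comp_act {A : C} {Y : V} (f : Y ⟶ (A ⟶[V] c)) :
    f ≫ act F x A = eAct F f (toUnit Y ≫ x) := by
  rw [act, comp_eAct, Category.comp_id, ← Category.assoc, toUnit_unique (f ≫ toUnit _) (toUnit _)]

lemma eMul_act {A B : C} {Y : V} (k : Y ⟶ (A ⟶[V] B)) (w : Y ⟶ (B ⟶[V] c)) :
    eMul k w ≫ act F x A = eAct F k (w ≫ act F x B) := by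
  rw [comp_act, comp_act, eMul_eAct]

lemma hApp_yonedaApp_eq_act {A : C} {Y : V} (w : Y ⟶ (A ⟶[V] c)) :
    hApp w (toUnit Y ≫ yonedaApp F c x A) = w ≫ act F x A := by
  rw [hApp_yonedaApp, comp_act]

/-- The inverse transformation: if all maps `C(A, c) ⟶ F A` are invertible, then their inverses are
`V`-natural. -/
def yonedaInv (h : ∀ A, IsIso (act F x A)) : VNatTrans F (rep V c) where
  app A := homName (@inv _ _ _ _ (act F x A.unop) (h A.unop))
  naturality A B := by
    obtain ⟨A⟩ := A
    obtain ⟨B⟩ := B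
    have e : ∀ (Y Z : V) (t : 𝟙_ V ⟶ Z),
        snd Y (B ⟶[V] A) ≫ toUnit _ ≫ t = toUnit _ ≫ t := fun Y Z t => by
      rw [← Category.assoc, toUnit_unique (snd _ _ ≫ toUnit _) (toUnit _)]
    change eMul (C := V) (A := F.obj (op A)) (B := F.obj (op B)) (D := (B ⟶[V] c))
        (F.map (op A) (op B)) (toUnit (B ⟶[V] A) ≫ homName (inv (act F x B))) =
      eMul (C := V) (A := F.obj (op A)) (B := (A ⟶[V] c)) (D := (B ⟶[V] c))
        (toUnit (B ⟶[V] A) ≫ homName (inv (act F x A))) (repMap c B A)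
    apply ihom_hom_ext
    rw [comp_eMul, comp_eMul, hApp_eMul, hApp_eMul]
    erw [e, e]
    let z := fst (F.obj (op A)) (B ⟶[V] A)
    let k := snd (F.obj (op A)) (B ⟶[V] A)
    have h₁ := hApp_homName (inv (act F x B)) (hApp z (k ≫ F.map (op A) (op B)))
    have h₂ : hApp (hApp z (toUnit _ ≫ homName (inv (act F x A)))) (k ≫ repMap c B A) =
        eMul k (z ≫ inv (act F x A)) := by
      rw [hApp_homName, hApp_repMap]
    refine h₁.trans (Eq.trans ?_ h₂.symm)
    -- After composing with `act F x B`, both sides become `k · z`, by associativity of the action.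
    rw [← cancel_mono (act F x B), eMul_act]
    simp only [Category.assoc, IsIso.inv_hom_id, Category.comp_id]
    exact (eAct_eq F _ _).symm

/-- `(c, x)` represents `F` if and only if all maps `C(A, c) ⟶ F A`, `f ↦ f · x`, are
invertible. -/
theorem isVRepresentable_iff : IsVRepresentable F c x ↔ ∀ A, IsIso (act F x A) := by
  constructor
  · rintro ⟨β, hβ⟩ A
    obtain ⟨h₁, h₂⟩ := hβ (op A)
    let b : 𝟙_ V ⟶ (ihom (F.obj (op A))).obj (A ⟶[V] c) := β.app (op A)
    refine ⟨hApp (𝟙 _) (toUnit _ ≫ b), ?_, ?_⟩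
    · have k := hApp_hApp_of_eMul_eq_eId (yonedaApp F c x A) b h₁ (𝟙 (A ⟶[V] c))
      rw [hApp_yonedaApp_eq_act, Category.id_comp] at k
      rw [comp_hApp, Category.comp_id, ← Category.assoc,
        toUnit_unique (act F x A ≫ toUnit _) (toUnit _), k]
    · have k := hApp_hApp_of_eMul_eq_eId b (yonedaApp F c x A) h₂ (𝟙 (F.obj (op A)))
      rwa [hApp_yonedaApp_eq_act] at k
  · intro h
    refine ⟨yonedaInv F x h, fun ⟨A⟩ => ⟨?_, ?_⟩⟩
    · change eMul (C := V) (A := (A ⟶[V] c)) (B := F.obj (op A)) (D := (A ⟶[V] c))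
        (yonedaApp F c x A) (homName (inv (act F x A))) = eId V (A ⟶[V] c)
      refine eMul_eq_eId _ _ fun T w => ?_
      rw [hApp_homName, hApp_yonedaApp_eq_act, Category.assoc, IsIso.hom_inv_id, Category.comp_id]
    · change eMul (C := V) (A := F.obj (op A)) (B := (A ⟶[V] c)) (D := F.obj (op A))
        (homName (inv (act F x A))) (yonedaApp F c x A) = eId V (F.obj (op A))
      refine eMul_eq_eId _ _ fun T w => ?_
      rw [hApp_yonedaApp_eq_act, hApp_homName, Category.assoc, IsIso.inv_hom_id, Category.comp_id]

/-- If `F` preserves the tensor `A ⊗ X`, maps `X ⟶ F A` correspond to global elements of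
`F (A ⊗ X)`. -/
lemma bijective_eAct_of_preserves {A : C} {X : V} (T : VTensor A X)
    (φ : (ihom X).obj (F.obj (op A)) ≅ F.obj (op T.obj))
    (hφ : (T.γ ⊗ₘ φ.hom) ≫ ev F A T.obj = (ihom.ev X).app (F.obj (op A))) :
    Function.Bijective fun z : 𝟙_ V ⟶ F.obj (op T.obj) => eAct F T.γ (toUnit X ≫ z) := by
  have hκ : ∀ z : 𝟙_ V ⟶ F.obj (op T.obj),
      eAct F T.γ (toUnit X ≫ z) = hApp (𝟙 X) (toUnit X ≫ z ≫ φ.inv) := fun z => by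
    rw [hApp, ← hφ, ← Category.assoc, eAct]
    congr 1
    apply CartesianMonoidalCategory.hom_ext <;> simp
  constructor
  · intro z z' e
    simp only [hκ] at e
    rw [← cancel_mono φ.inv]
    apply eq_of_hApp
    intro T' w
    have e' := w ≫= e
    rwa [comp_hApp, comp_hApp, Category.comp_id, ← Category.assoc, ← Category.assoc w,
      toUnit_unique (w ≫ toUnit _) (toUnit _)] at e'
  · intro f
    refine ⟨homName f ≫ φ.hom, ?_⟩
    simp only [hκ, Category.assoc, Iso.hom_inv_id, Category.comp_id]
    rw [hApp_homName, Category.id_comp]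

/-- A tensor `A ⊗ X` preserved by `F` identifies postcomposition with `C(A, c) ⟶ F A` on maps out
of `X` with postcomposition with `C(A ⊗ X, c) ⟶ F (A ⊗ X)` on global elements. -/
lemma bijective_of_tensor {A : C} {X : V} (T : VTensor A X)
    (hT : ∃ φ : (ihom X).obj (F.obj (op A)) ≅ F.obj (op T.obj),
      (T.γ ⊗ₘ φ.hom) ≫ ev F A T.obj = (ihom.ev X).app (F.obj (op A)))
    (h : Function.Bijective fun g : 𝟙_ V ⟶ (T.obj ⟶[V] c) => g ≫ act F x T.obj) :
    Function.Bijective fun g : X ⟶ (A ⟶[V] c) => g ≫ act F x A := by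
  obtain ⟨φ, hφ⟩ := hT
  have hc := (bijective_eAct_of_preserves F T φ hφ).comp h
  have e : (fun z : 𝟙_ V ⟶ F.obj (op T.obj) => eAct F T.γ (toUnit X ≫ z)) ∘
      (fun g : 𝟙_ V ⟶ (T.obj ⟶[V] c) => g ≫ act F x T.obj) =
      (fun g : X ⟶ (A ⟶[V] c) => g ≫ act F x A) ∘
        fun h : 𝟙_ V ⟶ (T.obj ⟶[V] c) => eMul T.γ (toUnit X ≫ h) := by
    funext g
    simp only [Function.comp_apply]
    rw [eMul_act, Category.assoc]
  rw [e] at hc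
  exact (Function.Bijective.of_comp_iff _ (T.bijective c)).1 hc

end Act

/-! ### Terminal objects of underlying `V`-categories -/

section Terminal

variable {V : Type u} [Category.{v} V] [HasPullbacks V] [CartesianMonoidalCategory V]
  {𝔸 : InternalCategory V}

/-- The hom-object from `a` to `b` is the fibre over `a` of the source map on morphisms into `b`. -/
lemma Und.isPullback_homObj (a b : 𝟙_ V ⟶ 𝔸.obj) :
    IsPullback (pullback.lift (proj 𝔸 a b) (toUnit _) (proj_tgt a b)) (toUnit _)
      (pullback.fst 𝔸.tgt b ≫ 𝔸.src) a := by
  have hs : ∀ s : PullbackCone (pullback.fst 𝔸.tgt b ≫ 𝔸.src) a,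
      (s.fst ≫ pullback.fst _ _) ≫ 𝔸.src = toUnit _ ≫ a := fun s => by
    rw [Category.assoc, s.condition, toUnit_unique s.snd (toUnit _)]
  have ht : ∀ s : PullbackCone (pullback.fst 𝔸.tgt b ≫ 𝔸.src) a,
      (s.fst ≫ pullback.fst _ _) ≫ 𝔸.tgt = toUnit _ ≫ b := fun s => by
    rw [Category.assoc, pullback.condition, ← Category.assoc,
      toUnit_unique (s.fst ≫ pullback.snd _ _) (toUnit _)]
  refine ⟨⟨by rw [pullback.lift_fst_assoc, proj_src]⟩,
    ⟨PullbackCone.IsLimit.mk _ (fun s => homLift _ (hs s) (ht s)) (fun s => ?_)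
      (fun s => toUnit_unique _ _) (fun s m h₁ _ => ?_)⟩⟩
  · apply pullback.hom_ext
    · rw [Category.assoc, pullback.lift_fst, homLift_proj]
    · exact toUnit_unique _ _
  · apply Und.hom_ext
    rw [homLift_proj, ← h₁, Category.assoc, pullback.lift_fst]

/-- An object `b` is `V`-terminal if and only if all fibres of the source map on morphisms into `b`
are terminal. -/
lemma Und.isVTerminal_iff (b : 𝟙_ V ⟶ 𝔸.obj) :
    IsVTerminal V (D := Und 𝔸) b ↔ ∀ a : 𝟙_ V ⟶ 𝔸.obj, ∃ r : 𝟙_ V ⟶ pullback 𝔸.tgt b,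
      IsPullback r (𝟙 _) (pullback.fst 𝔸.tgt b ≫ 𝔸.src) a := by
  constructor
  · intro h a
    have : IsIso (toUnit (homObj 𝔸 a b)) := h a
    refine ⟨inv (toUnit (homObj 𝔸 a b)) ≫
      pullback.lift (proj 𝔸 a b) (toUnit _) (proj_tgt a b),
      IsPullback.of_iso (isPullback_homObj a b)
      (asIso (toUnit (homObj 𝔸 a b))) (Iso.refl _) (Iso.refl _) (Iso.refl _) ?_ ?_ ?_ ?_⟩
    · rw [asIso_hom, IsIso.hom_inv_id_assoc, Iso.refl_hom, Category.comp_id]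
    · exact toUnit_unique _ _
    · simp
    · simp
  · intro h a
    obtain ⟨r, hr⟩ := h a
    -- The map to `*` is one direction of the comparison of two pullbacks.
    have e := hr.isoIsPullback_inv_snd _ _ (isPullback_homObj a b)
    rw [Category.comp_id] at e
    change IsIso (toUnit (homObj 𝔸 a b))
    rw [← e]
    infer_instance

end Terminal

/-! ### Morphisms into `(c, x)` in the category of elements -/

section Fiber

/-- The fibre of the projection `X × Y ⟶ Y` over `y : * ⟶ Y` is `X`. -/
lemma isPullback_lift_toUnit {V : Type u} [Category.{v} V] [CartesianMonoidalCategory V]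
    (X : V) {Y : V} (y : 𝟙_ V ⟶ Y) :
    IsPullback (lift (𝟙 X) (toUnit X ≫ y)) (toUnit X) (snd X Y) y := by
  have h : (ρ_ X).hom = fst X (𝟙_ V) := rightUnitor_hom X
  refine IsPullback.of_iso (isPullback_whiskerLeft X y) (ρ_ X) (Iso.refl _) (Iso.refl _)
    (Iso.refl _) ?_ ?_ ?_ ?_
  · apply CartesianMonoidalCategory.hom_ext
    · simp [h]
    · simp only [Iso.refl_hom, Category.comp_id, whiskerLeft_snd, Category.assoc, lift_snd]
      rw [← Category.assoc, toUnit_unique ((ρ_ X).hom ≫ toUnit _) (snd _ _)]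
  · exact toUnit_unique _ _
  · simp
  · simp

variable {V : Type u} [Category.{v} V] [CartesianMonoidalCategory V] [BraidedCategory V]
  [MonoidalClosed V] [HasCoproducts.{w} V] [HasPullbacks V]
  {C : Type w} [EnrichedCategory V C] (F : EnrichedFunctor V Cᵒᵖ V)
  {c : C} (x : 𝟙_ V ⟶ F.obj (op c))

/-- The fibre of the target map of the category of elements over `(c, x)`: the object of morphisms
into `(c, x)`. -/
abbrev fiber : V := pullback (elTgt F) (x ≫ elObjι F c)

/-- The source map on morphisms into `(c, x)`. -/
abbrev fiberSrc : fiber F x ⟶ elObj F := pullback.fst _ _ ≫ elSrc F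

/-- The inclusion of `C(A, c)` into the object of morphisms into `(c, x)`. -/
def fiberι (A : C) : (A ⟶[V] c) ⟶ fiber F x :=
  pullback.lift (lift (𝟙 _) (toUnit _ ≫ x) ≫ elMorι F A c) (toUnit _) (by
    rw [Category.assoc, ι_elTgt, lift_snd_assoc, Category.assoc])

lemma fiberι_fst (A : C) : fiberι F x A ≫ pullback.fst _ _ =
    lift (𝟙 _) (toUnit _ ≫ x) ≫ elMorι F A c := pullback.lift_fst _ _ _

lemma fiberι_fiberSrc (A : C) : fiberι F x A ≫ fiberSrc F x = act F x A ≫ elObjι F A := by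
  rw [fiberSrc, ← Category.assoc, fiberι_fst, Category.assoc, ι_elSrc, ← Category.assoc]
  rfl

variable [IsExtensive.{w} V]

/-- By extensivity, the object of morphisms into `(c, x)` is `∐ A, C(A, c)`. -/
lemma isColimit_fiberι : Nonempty (IsColimit (Cofan.mk (fiber F x) (fiberι F x))) := by
  obtain ⟨h⟩ := isColimit_fiberProduct (I := C) (K := C) (J := PUnit.{w + 1})
    (fun p => elMorι F p.1 p.2) (coproductIsCoproduct _)
    (fun A => elObjι F A) (coproductIsCoproduct _)
    (elTgt F) (fun _ _ => snd _ _) (fun A B => ι_elTgt F A B) (fun _ => c)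
    (S := fun _ => 𝟙_ V) (S' := 𝟙_ V) (fun _ => 𝟙 _)
    (Cofan.IsColimit.mk _ (fun s => s.inj ⟨⟩) (fun s j => Category.id_comp _)
      (fun s m hm => (Category.id_comp _).symm.trans (hm ⟨⟩)))
    (x ≫ elObjι F c) (fun _ => x) (fun _ => Category.id_comp _)
    (W := fun A _ => (A ⟶[V] c))
    (fun A _ => lift (𝟙 _) (toUnit _ ≫ x)) (fun A _ => toUnit _)
    (fun A _ => isPullback_lift_toUnit _ x)
    (pullback.fst _ _) (pullback.snd _ _) (IsPullback.of_hasPullback _ _)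
    (fun q => fiberι F x q.1) (fun A _ => fiberι_fst F x A) (fun A _ => toUnit_unique _ _)
  -- The index type `C × PUnit` is replaced by `C`.
  exact ⟨Cofan.IsColimit.mk _ (fun s => Cofan.IsColimit.desc h fun q => s.inj q.1)
    (fun s A => Cofan.IsColimit.fac h (fun q => s.inj q.1) (A, ⟨⟩))
    (fun s m hm => Cofan.IsColimit.hom_ext h _ _ fun q =>
      (hm q.1).trans (Cofan.IsColimit.fac h (fun q => s.inj q.1) q).symm)⟩

/-- Summands of a coproduct of maps are pullbacks, so `C(A, c) ⟶ F A` is the restriction to `F A` of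
the source map on morphisms into `(c, x)`. -/
lemma isPullback_fiberι (A : C) :
    IsPullback (fiberι F x A) (act F x A) (fiberSrc F x) (elObjι F A) :=
  isPullback_cofan (fiberι F x) (isColimit_fiberι F x).some (fun A => elObjι F A)
    (coproductIsCoproduct _) (act F x) (fiberSrc F x) (fiberι_fiberSrc F x) A

/-- The source map on morphisms into `(c, x)` is the coproduct of the maps `C(A, c) ⟶ F A`, so it
is invertible if they are. -/
lemma isIso_fiberSrc (h : ∀ A, IsIso (act F x A)) : IsIso (fiberSrc F x) := by
  refine ⟨Sigma.desc fun A => inv (act F x A) ≫ fiberι F x A, ?_, ?_⟩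
  · apply Cofan.IsColimit.hom_ext (isColimit_fiberι F x).some
    intro A
    change fiberι F x A ≫ _ = fiberι F x A ≫ _
    rw [← Category.assoc, fiberι_fiberSrc, Category.assoc, Limits.Sigma.ι_desc]
    simp
  · apply Limits.Sigma.hom_ext
    intro A
    rw [Limits.Sigma.ι_desc_assoc, Category.assoc, fiberι_fiberSrc]
    simp

/-- If `(c, x)` is `V`-terminal, global elements of `F A` lift uniquely to `C(A, c)`. -/
lemma bijective_of_isVTerminal (h : IsVTerminal V (elMk F c x)) (A : C) :
    Function.Bijective fun g : 𝟙_ V ⟶ (A ⟶[V] c) => g ≫ act F x A := by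
  have hA := isPullback_fiberι F x A
  have key : ∀ y : 𝟙_ V ⟶ F.obj (op A), ∃ r : 𝟙_ V ⟶ fiber F x,
      IsPullback r (𝟙 _) (fiberSrc F x) (y ≫ elObjι F A) :=
    fun y => (Und.isVTerminal_iff (𝔸 := elements F) (x ≫ elObjι F c)).1 h (y ≫ elObjι F A)
  constructor
  · intro g g' e
    simp only at e
    obtain ⟨r, hr⟩ := key (g ≫ act F x A)
    -- All lifts of `g ≫ act F x A` agree in the fibre, which has a single global element over it.
    have hu : ∀ k : 𝟙_ V ⟶ (A ⟶[V] c), k ≫ act F x A = g ≫ act F x A →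
        k ≫ fiberι F x A = r := fun k hk => by
      have hw : (k ≫ fiberι F x A) ≫ fiberSrc F x = 𝟙 _ ≫ (g ≫ act F x A) ≫ elObjι F A := by
        rw [Category.assoc, hA.w, ← hk, Category.id_comp, Category.assoc]
      have h₁ := hr.lift_fst _ _ hw
      have h₂ := hr.lift_snd _ _ hw
      rw [Category.comp_id] at h₂
      rw [← h₁, h₂, Category.id_comp]
    exact hA.hom_ext ((hu g rfl).trans (hu g' e.symm).symm) e
  · intro y
    obtain ⟨r, hr⟩ := key y
    have hw : r ≫ fiberSrc F x = y ≫ elObjι F A := by rw [hr.w, Category.id_comp]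
    exact ⟨hA.lift r y hw, hA.lift_snd _ _ _⟩

lemma isVTerminal_of_isIso_act (h : ∀ A, IsIso (act F x A)) : IsVTerminal V (elMk F c x) := by
  have hi : IsIso (fiberSrc F x) := isIso_fiberSrc F x h
  have key : ∀ a : 𝟙_ V ⟶ elObj F,
      IsPullback (a ≫ inv (fiberSrc F x)) (𝟙 _) (fiberSrc F x) a := fun a =>
    IsPullback.of_vert_isIso ⟨by rw [Category.assoc, IsIso.inv_hom_id, Category.comp_id,
      Category.id_comp]⟩
  refine (Und.isVTerminal_iff (𝔸 := elements F) (x ≫ elObjι F c)).2 fun a => ⟨_, key a⟩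

end Fiber

end EnrichedRep

end

open EnrichedRep
theorem mainTheorem7 {V : Type u} [Category.{v} V] [CartesianMonoidalCategory V]
    [BraidedCategory V] [MonoidalClosed V] [HasPullbacks V] [HasCoproducts.{w} V]
    [IsExtensive.{w} V] (G : Set V) (hG : IsConservativeFamily G)
    {C : Type w} [EnrichedCategory V C] (hC : ∀ X ∈ G, HasTensorsBy C X)
    (F : EnrichedFunctor V Cᵒᵖ V) (hF : ∀ X ∈ G, PreservesTensorsBy F X)
    (c : C) (x : 𝟙_ V ⟶ F.obj (op c)) :
    IsVRepresentable F c x ↔ IsVTerminal V (elMk F c x) := by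
  rw [isVRepresentable_iff]
  refine ⟨isVTerminal_of_isIso_act F x, fun h A => (hG _).2 fun X hX => ?_⟩
  obtain ⟨T⟩ := hC X hX A
  exact bijective_of_tensor F x T (hF X hX A T) (bijective_of_isVTerminal F x h T.obj)
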